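/- Let $\mathbf F$ be $\mathbf R$ or $\mathbf C$, let $n\ge 1$, and let $\mathbf P(\mathbf F^n)$ be the space of lines through $0$ in $\mathbf F^n$, with its usual manifold structure given by affine charts. Let $$X=\{(x,[y])\in\mathbf F^n\times\mathbf P(\mathbf F^n) : x_jy_k=x_ky_j\ \text{for all } j,k\},\qquad q_X\colon X\to\mathbf F^n,\quad q_X(x,[y])=x,$$ with its manifold structure given by the charts on $\{y_j\ne0\}$ with coordinates $x_j$ and $y_i/y_j$ ($i\neq j$). For a map $h$ between neighbourhoods of $0$ in $\mathbf F^n$ which is injective, fixes $0$, and has invertible $\mathbf F$-linear derivative $Dh|_0$, let $\widehat h$ be its lift to the parts of $X$ over these neighbourhoods: $\widehat h(x,[x])=(h(x),[h(x)])$ for $x\ne0$ and $\widehat h(0,[y])=(0,[Dh|_0(y)])$. Let $M$ be a (Hausdorff) manifold modelled on $\mathbf F^n$, smooth ($C^\infty$) if $\mathbf F=\mathbf R$ and complex (holomorphic) if $\mathbf F=\mathbf C$, and let $p\in M$. "Isomorphism" means $C^\infty$ diffeomorphism if $\mathbf F=\mathbf R$ and biholomorphism if $\mathbf F=\mathbf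 C$. Then there are a (Hausdorff) manifold $\widehat M$ of the same kind, modelled on $\mathbf F^n$ and second countable if $M$ is, and a smooth (respectively holomorphic) map $q\colon\widehat M\to M$, such that with $\Sigma=q^{-1}(\{p\})$: 1. $q$ is a quotient map, $\Sigma$ is nonempty, connected and compact, and $q$ restricts to a homeomorphism $\widehat M\setminus\Sigma\to M\setminus\{p\}$, that is, $q$ is a topological blowup of $M$ at $p$; 2. this restriction $q|\colon\widehat M\setminus\Sigma\to M\setminus\{p\}$ is an isomorphism of manifolds; 3. $\Sigma\cong\mathbf P(\mathbf F^n)$: there is a smooth (respectively holomorphic) embedding $\mathbf P(\mathbf F^n)\to\widehat M$ with image $\Sigma$; 4. $\widehat M$ is glued from the model $X$ by lifted coordinate changes: to every chart $\varphi\colon U\to\varphi(U)\subseteq\mathbf F^n$ of $M$ with $p\in U$ and $\varphi(p)=0$ one can assign an isomorphism $\Phi_\varphi\colon q^{-1}(U)\to q_X^{-1}(\varphi(U))$ with $q_X\circ\Phi_\varphi=\varphi\circ q$, in such a way that for any two such charts $\varphi\colon U\to\mathbf F^n$ and $\psi\colon U'\to\mathbf F^n$ $$\Phi_\psi\circ\Phi_\varphi^{-1}=\widehat{\psi\circ\varphi^{-1}}\quad\text{on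 } q_X^{-1}(\varphi(U\cap U')).$$ -/

import Mathlib

open Set Topology Manifold
open TopologicalSpace (Opens)
open scoped ContDiff LinearAlgebra.Projectivization

universe u v

noncomputable section

/-! ### Topological blowups -/

/-- A continuous map `q : V → M` of topological spaces is a topological blowup of `M` at `p` if it
is a quotient map, the exceptional locus `q ⁻¹' {p}` is nonempty, connected and compact, and `q`
restricts to a homeomorphism `V ∖ q ⁻¹' {p} → M ∖ {p}`.  (Recall that `IsConnected` includes
nonemptiness.  That `V` and `M` are manifolds of the same dimension is recorded separately, by
charted space structures over the same model.) -/
structure IsTopologicalBlowup {V M : Type*} [TopologicalSpace V] [TopologicalSpace M]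
    (q : V → M) (p : M) : Prop where
  isQuotientMap : IsQuotientMap q
  isConnected : IsConnected (q ⁻¹' {p})
  isCompact : IsCompact (q ⁻¹' {p})
  isHomeomorph : IsHomeomorph (({p}ᶜ : Set M).restrictPreimage q)

/-! ### The projective space `P(𝕜ⁿ⁺¹)` as a manifold -/

namespace Projectivization

section
variable {𝕜 : Type*} [RCLike 𝕜] {n : ℕ}

/-- The quotient topology on the projectivization of a topological vector space. -/
instance instQuotientTopology (K W : Type*) [DivisionRing K] [AddCommGroup W] [Module K W]
    [TopologicalSpace W] : TopologicalSpace (ℙ K W) :=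
  inferInstanceAs (TopologicalSpace (Quotient (projectivizationSetoid K W)))

theorem isQuotientMap_mk' (K W : Type*) [DivisionRing K] [AddCommGroup W] [Module K W]
    [TopologicalSpace W] : IsQuotientMap (Projectivization.mk' K : {w : W // w ≠ 0} → ℙ K W) :=
  isQuotientMap_quotient_mk'

theorem rep_mk_spec (y : EuclideanSpace 𝕜 (Fin n)) (hy : y ≠ 0) :
    ∃ a : 𝕜, a ≠ 0 ∧ ∀ i, (mk 𝕜 y hy).rep i = a * y i := by
  obtain ⟨a, ha⟩ := exists_smul_eq_mk_rep 𝕜 y hy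
  refine ⟨a, a.ne_zero, fun i => ?_⟩
  rw [← ha]
  rfl

theorem rep_mk_ne_zero_iff (y : EuclideanSpace 𝕜 (Fin n)) (hy : y ≠ 0) (i : Fin n) :
    (mk 𝕜 y hy).rep i ≠ 0 ↔ y i ≠ 0 := by
  obtain ⟨a, ha, h⟩ := rep_mk_spec y hy
  simp [h, ha]

theorem rep_mk_div (y : EuclideanSpace 𝕜 (Fin n)) (hy : y ≠ 0) (i j : Fin n) :
    (mk 𝕜 y hy).rep i / (mk 𝕜 y hy).rep j = y i / y j := by
  obtain ⟨a, ha, h⟩ := rep_mk_spec y hy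
  rw [h, h, mul_div_mul_left _ _ ha]

theorem exists_rep_ne_zero (l : ℙ 𝕜 (EuclideanSpace 𝕜 (Fin n))) : ∃ j, l.rep j ≠ 0 := by
  by_contra! h
  exact l.rep_nonzero (by ext i; simpa using h i)

/-- The vector `(w₀, …, 1, …, wₙ₋₁)` with `1` inserted in position `j`. -/
def insertOne (j : Fin (n + 1)) (w : EuclideanSpace 𝕜 (Fin n)) : EuclideanSpace 𝕜 (Fin (n + 1)) :=
  WithLp.toLp 2 (j.insertNth (1 : 𝕜) (fun i => w i) : Fin (n + 1) → 𝕜)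

@[simp] theorem insertOne_self (j : Fin (n + 1)) (w : EuclideanSpace 𝕜 (Fin n)) :
    insertOne j w j = 1 := by
  simp [insertOne]

@[simp] theorem insertOne_succAbove (j : Fin (n + 1)) (w : EuclideanSpace 𝕜 (Fin n)) (i : Fin n) :
    insertOne j w (j.succAbove i) = w i := by
  simp [insertOne]

theorem insertOne_ne_zero (j : Fin (n + 1)) (w : EuclideanSpace 𝕜 (Fin n)) :
    insertOne j w ≠ 0 := fun h => by
  have := insertOne_self j w
  rw [h] at this
  simp at this

theorem contDiff_insertOne (j : Fin (n + 1)) (k : ℕ∞ω) :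
    ContDiff 𝕜 k (insertOne (𝕜 := 𝕜) j) := by
  rw [contDiff_euclidean]
  intro i
  cases i using j.succAboveCases with
  | x => simpa using contDiff_const
  | p i =>
    simp only [insertOne_succAbove]
    exact contDiff_euclidean.1 contDiff_id i

theorem continuous_affineInv (j : Fin (n + 1)) :
    Continuous fun w : EuclideanSpace 𝕜 (Fin n) => mk 𝕜 (insertOne j w) (insertOne_ne_zero j w) :=
  (isQuotientMap_mk' 𝕜 _).continuous.comp
    (((contDiff_insertOne (𝕜 := 𝕜) j 0).continuous).subtype_mk (insertOne_ne_zero j))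

theorem isOpen_rep_ne_zero (j : Fin n) :
    IsOpen {l : ℙ 𝕜 (EuclideanSpace 𝕜 (Fin n)) | l.rep j ≠ 0} := by
  rw [← (isQuotientMap_mk' 𝕜 _).isOpen_preimage]
  have : (Projectivization.mk' 𝕜 ⁻¹' {l : ℙ 𝕜 (EuclideanSpace 𝕜 (Fin n)) | l.rep j ≠ 0})
      = {y | y.1 j ≠ 0} := by
    ext y
    exact rep_mk_ne_zero_iff y.1 y.2 j
  rw [this]
  exact isOpen_ne_fun (by fun_prop) continuous_const

theorem continuousOn_rep_div (i j : Fin n) :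
    ContinuousOn (fun l : ℙ 𝕜 (EuclideanSpace 𝕜 (Fin n)) => l.rep i / l.rep j)
      {l | l.rep j ≠ 0} := by
  rw [(isQuotientMap_mk' 𝕜 _).continuousOn_isOpen_iff (isOpen_rep_ne_zero j)]
  have : ContinuousOn (fun y : {y : EuclideanSpace 𝕜 (Fin n) // y ≠ 0} => y.1 i / y.1 j)
      {y | y.1 j ≠ 0} :=
    ContinuousOn.div (by fun_prop) (by fun_prop) (fun y hy => hy)
  refine (this.mono fun y hy => ?_).congr fun y _ => rep_mk_div y.1 y.2 i j
  exact (rep_mk_ne_zero_iff y.1 y.2 j).1 hy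

/-- The standard affine chart `[y₀, …, yₙ] ↦ (yᵢ / yⱼ)_{i ≠ j}` of projective space, defined on
`{yⱼ ≠ 0}`; its inverse inserts `1` in position `j`. -/
def affineChart (𝕜 : Type*) [RCLike 𝕜] (n : ℕ) (j : Fin (n + 1)) :
    OpenPartialHomeomorph (ℙ 𝕜 (EuclideanSpace 𝕜 (Fin (n + 1)))) (EuclideanSpace 𝕜 (Fin n)) where
  toFun l := WithLp.toLp 2 fun i => l.rep (j.succAbove i) / l.rep j
  invFun w := mk 𝕜 (insertOne j w) (insertOne_ne_zero j w)
  source := {l | l.rep j ≠ 0}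
  target := univ
  map_source' _ _ := mem_univ _
  map_target' w _ := (rep_mk_ne_zero_iff _ _ j).2 (by simp)
  left_inv' l hl := by
    conv_rhs => rw [← l.mk_rep]
    rw [mk_eq_mk_iff']
    refine ⟨(l.rep j)⁻¹, ?_⟩
    ext i
    cases i using j.succAboveCases with
    | x => simpa using inv_mul_cancel₀ hl
    | p i => simp [div_eq_inv_mul]
  right_inv' w _ := by
    ext i
    simp [rep_mk_div]
  open_source := isOpen_rep_ne_zero j
  open_target := isOpen_univ
  continuousOn_toFun :=
    (PiLp.continuous_toLp 2 _).comp_continuousOn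
      (continuousOn_pi.2 fun i => continuousOn_rep_div (j.succAbove i) j)
  continuousOn_invFun := (continuous_affineInv j).continuousOn

/-- The projective space `P(𝕜ⁿ⁺¹)`, with its atlas of affine charts. -/
instance instChartedSpace :
    ChartedSpace (EuclideanSpace 𝕜 (Fin n)) (ℙ 𝕜 (EuclideanSpace 𝕜 (Fin (n + 1)))) where
  atlas := range (affineChart 𝕜 n)
  chartAt l := affineChart 𝕜 n (exists_rep_ne_zero l).choose
  mem_chart_source l := (exists_rep_ne_zero l).choose_spec
  chart_mem_atlas _ := mem_range_self _

instance instIsManifold :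
    IsManifold 𝓘(𝕜, EuclideanSpace 𝕜 (Fin n)) ∞ (ℙ 𝕜 (EuclideanSpace 𝕜 (Fin (n + 1)))) := by
  refine isManifold_of_contDiffOn _ _ _ ?_
  rintro _ _ ⟨j, rfl⟩ ⟨k, rfl⟩
  have h (i : Fin (n + 1)) : ContDiff 𝕜 ∞ fun w : EuclideanSpace 𝕜 (Fin n) => insertOne j w i :=
    contDiff_euclidean.1 (contDiff_insertOne (𝕜 := 𝕜) j ∞) i
  have key : ContDiffOn 𝕜 ∞ (fun w : EuclideanSpace 𝕜 (Fin n) =>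
      WithLp.toLp 2 fun i => insertOne j w (k.succAbove i) / insertOne j w k)
      {w | insertOne j w k ≠ 0} := by
    rw [contDiffOn_euclidean]
    exact fun i => (h _).contDiffOn.div (h _).contDiffOn fun w hw => hw
  refine (key.mono ?_).congr ?_
  · rintro w hw
    simp only [mfld_simps] at hw
    exact (rep_mk_ne_zero_iff _ _ _).1 hw.2
  · intro w _
    ext i
    exact rep_mk_div _ _ _ _

end

end Projectivization

/-! ### The model blowup `X` of the origin in `𝕜ᵐ` -/

/-- The model `X = {(x, [y]) | xⱼ yₖ = xₖ yⱼ for all j, k} ⊆ 𝕜ᵐ × P(𝕜ᵐ)`.  (The condition does not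
depend on the representative `y`, see `BlowupModel.mem_iff`.) -/
def BlowupModel (𝕜 : Type*) [RCLike 𝕜] (m : ℕ) : Type _ :=
  {z : EuclideanSpace 𝕜 (Fin m) × ℙ 𝕜 (EuclideanSpace 𝕜 (Fin m)) //
    ∀ j k, z.1 j * z.2.rep k = z.1 k * z.2.rep j}

namespace BlowupModel

open Projectivization

section
variable {𝕜 : Type*} [RCLike 𝕜] {m n : ℕ}

/-- The subspace topology from `𝕜ᵐ × P(𝕜ᵐ)`. -/
instance : TopologicalSpace (BlowupModel 𝕜 m) :=
  inferInstanceAs (TopologicalSpace (Subtype _))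

theorem mem_iff (x y : EuclideanSpace 𝕜 (Fin m)) (hy : y ≠ 0) :
    (∀ j k, x j * (mk 𝕜 y hy).rep k = x k * (mk 𝕜 y hy).rep j) ↔
      ∀ j k, x j * y k = x k * y j := by
  obtain ⟨a, ha, h⟩ := rep_mk_spec y hy
  refine forall₂_congr fun j k => ?_
  rw [h, h, mul_left_comm, mul_left_comm (x k), mul_right_inj' ha]

/-- The blowdown map `q : X → 𝕜ᵐ`, `(x, [y]) ↦ x`. -/
def blowdown (z : BlowupModel 𝕜 m) : EuclideanSpace 𝕜 (Fin m) := z.1.1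

/-- The second projection `X → P(𝕜ᵐ)`, `(x, [y]) ↦ [y]`. -/
def line (z : BlowupModel 𝕜 m) : ℙ 𝕜 (EuclideanSpace 𝕜 (Fin m)) := z.1.2

theorem continuous_blowdown : Continuous (blowdown : BlowupModel 𝕜 m → _) :=
  continuous_fst.comp continuous_subtype_val

theorem continuous_line : Continuous (line : BlowupModel 𝕜 m → _) :=
  continuous_snd.comp continuous_subtype_val

/-- The point `(x, [y])` of `X`, for `y ≠ 0` and `x = μ y`. -/
def ofSMul (μ : 𝕜) (y : EuclideanSpace 𝕜 (Fin m)) (hy : y ≠ 0) : BlowupModel 𝕜 m :=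
  ⟨(μ • y, mk 𝕜 y hy), (mem_iff _ _ hy).2 fun j k => by
    simp only [PiLp.smul_apply, smul_eq_mul]; ring⟩

theorem blowdown_eq (z : BlowupModel 𝕜 m) (i j : Fin m) (hj : z.line.rep j ≠ 0) :
    z.blowdown i = z.blowdown j * (z.line.rep i / z.line.rep j) := by
  have := z.2 i j
  rw [← mul_div_assoc, eq_div_iff hj]
  exact this

/-- The vector `w` with its `j`-th coordinate replaced by `1`. -/
def replaceOne (j : Fin m) (w : EuclideanSpace 𝕜 (Fin m)) : EuclideanSpace 𝕜 (Fin m) :=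
  WithLp.toLp 2 fun i => if i = j then 1 else w i

@[simp] theorem replaceOne_apply (j i : Fin m) (w : EuclideanSpace 𝕜 (Fin m)) :
    replaceOne j w i = if i = j then 1 else w i := rfl

theorem replaceOne_ne_zero (j : Fin m) (w : EuclideanSpace 𝕜 (Fin m)) :
    replaceOne j w ≠ 0 := fun h => by
  have : replaceOne j w j = 1 := by simp
  rw [h] at this
  simp at this

theorem contDiff_replaceOne (j : Fin m) (k : ℕ∞ω) :
    ContDiff 𝕜 k (replaceOne (𝕜 := 𝕜) j) := by
  rw [contDiff_euclidean]
  intro i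
  simp only [replaceOne_apply]
  split_ifs
  · exact contDiff_const
  · exact contDiff_euclidean.1 contDiff_id i

/-- The standard chart of `X` on `{yⱼ ≠ 0}`: the point `(x, [y])` goes to the vector with `j`-th
coordinate `xⱼ` and `i`-th coordinate `yᵢ / yⱼ` for `i ≠ j`.  Its inverse sends `w` to
`(wⱼ y, [y])`, where `y` is `w` with its `j`-th coordinate replaced by `1`. -/
def chart (𝕜 : Type*) [RCLike 𝕜] (m : ℕ) (j : Fin m) :
    OpenPartialHomeomorph (BlowupModel 𝕜 m) (EuclideanSpace 𝕜 (Fin m)) where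
  toFun z := WithLp.toLp 2 fun i => if i = j then z.blowdown j else z.line.rep i / z.line.rep j
  invFun w := ofSMul (w j) (replaceOne j w) (replaceOne_ne_zero j w)
  source := {z | z.line.rep j ≠ 0}
  target := univ
  map_source' _ _ := mem_univ _
  map_target' w _ := (rep_mk_ne_zero_iff _ _ j).2 (by simp)
  left_inv' z hz := by
    have hz' : z.line.rep j ≠ 0 := hz
    refine Subtype.ext (Prod.ext ?_ ?_)
    · ext i
      change _ = z.blowdown i
      rw [blowdown_eq z i j hz']
      by_cases hi : i = j
      · subst hi
        simp [ofSMul, hz']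
      · simp [ofSMul, hi]
    · change Projectivization.mk 𝕜 _ _ = z.line
      conv_rhs => rw [← z.line.mk_rep]
      rw [mk_eq_mk_iff']
      refine ⟨(z.line.rep j)⁻¹, ?_⟩
      ext i
      by_cases hi : i = j
      · subst hi
        simpa using inv_mul_cancel₀ hz'
      · simp [hi, div_eq_inv_mul]
  right_inv' w _ := by
    ext i
    by_cases hi : i = j
    · subst hi
      simp [ofSMul, blowdown]
    · simp [ofSMul, line, hi, rep_mk_div]
  open_source := (isOpen_rep_ne_zero j).preimage continuous_line
  open_target := isOpen_univ
  continuousOn_toFun := by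
    refine (PiLp.continuous_toLp 2 _).comp_continuousOn (continuousOn_pi.2 fun i => ?_)
    by_cases hi : i = j
    · simp only [hi, if_true]
      exact ((EuclideanSpace.proj (𝕜 := 𝕜) j).continuous.comp continuous_blowdown).continuousOn
    · simp only [hi, if_false]
      exact (continuousOn_rep_div i j).comp continuous_line.continuousOn fun z hz => hz
  continuousOn_invFun := by
    refine Continuous.continuousOn (Continuous.subtype_mk (Continuous.prodMk ?_ ?_) _)
    · exact ((EuclideanSpace.proj (𝕜 := 𝕜) j).continuous).smul
        (contDiff_replaceOne (𝕜 := 𝕜) j 0).continuous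
    · exact (isQuotientMap_mk' 𝕜 _).continuous.comp
        ((contDiff_replaceOne (𝕜 := 𝕜) j 0).continuous.subtype_mk (replaceOne_ne_zero j))

instance : ChartedSpace (EuclideanSpace 𝕜 (Fin m)) (BlowupModel 𝕜 m) where
  atlas := range (chart 𝕜 m)
  chartAt z := chart 𝕜 m (exists_rep_ne_zero z.line).choose
  mem_chart_source z := (exists_rep_ne_zero z.line).choose_spec
  chart_mem_atlas _ := mem_range_self _

instance : IsManifold 𝓘(𝕜, EuclideanSpace 𝕜 (Fin m)) ∞ (BlowupModel 𝕜 m) := by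
  refine isManifold_of_contDiffOn _ _ _ ?_
  rintro _ _ ⟨j, rfl⟩ ⟨k, rfl⟩
  have h (i : Fin m) : ContDiff 𝕜 ∞ fun w : EuclideanSpace 𝕜 (Fin m) => replaceOne j w i :=
    contDiff_euclidean.1 (contDiff_replaceOne (𝕜 := 𝕜) j ∞) i
  have h' : ContDiff 𝕜 ∞ fun w : EuclideanSpace 𝕜 (Fin m) => w j :=
    contDiff_euclidean.1 contDiff_id j
  have key : ContDiffOn 𝕜 ∞ (fun w : EuclideanSpace 𝕜 (Fin m) =>
      WithLp.toLp 2 fun i =>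
        if i = k then w j * replaceOne j w k else replaceOne j w i / replaceOne j w k)
      {w | replaceOne j w k ≠ 0} := by
    rw [contDiffOn_euclidean]
    intro i
    by_cases hi : i = k
    · simp only [hi, if_true]
      exact (h'.mul (h k)).contDiffOn
    · simp only [hi, if_false]
      exact (h _).contDiffOn.div (h _).contDiffOn fun w hw => hw
  refine (key.mono ?_).congr ?_
  · rintro w hw
    simp only [mfld_simps] at hw
    exact (rep_mk_ne_zero_iff _ _ _).1 hw.2
  · intro w _
    ext i
    change (if i = k then w j * replaceOne j w k else
      (Projectivization.mk 𝕜 (replaceOne j w) (replaceOne_ne_zero j w)).rep i /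
        (Projectivization.mk 𝕜 (replaceOne j w) (replaceOne_ne_zero j w)).rep k) = _
    rw [rep_mk_div]

/-- The line `[v]` if `v ≠ 0`; the given default line `l` if `v = 0`. -/
def lineThrough (v : EuclideanSpace 𝕜 (Fin m)) (l : ℙ 𝕜 (EuclideanSpace 𝕜 (Fin m))) :
    ℙ 𝕜 (EuclideanSpace 𝕜 (Fin m)) :=
  open Classical in if hv : v = 0 then l else mk 𝕜 v hv

theorem lineThrough_mem (v : EuclideanSpace 𝕜 (Fin m)) (l : ℙ 𝕜 (EuclideanSpace 𝕜 (Fin m)))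
    (j k : Fin m) : v j * (lineThrough v l).rep k = v k * (lineThrough v l).rep j := by
  by_cases hv : v = 0
  · simp [hv]
  · simp only [lineThrough, hv, dite_false]
    exact (mem_iff v v hv).2 (fun j k => mul_comm _ _) j k

/-- The lift `ĥ : X → X` of a map `h` of `𝕜ᵐ` with `h 0 = 0`:
`ĥ (x, [x]) = (h x, [h x])` for `x ≠ 0`, and `ĥ (0, [y]) = (0, [Dh|₀ y])`.
The default values of `lineThrough` only matter if `h x = 0` for some `x ≠ 0`, or if `Dh|₀` is not
injective. -/
def lift (h : EuclideanSpace 𝕜 (Fin m) → EuclideanSpace 𝕜 (Fin m)) (z : BlowupModel 𝕜 m) :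
    BlowupModel 𝕜 m :=
  open Classical in
  if z.blowdown = 0 then
    ⟨(0, lineThrough (fderiv 𝕜 h 0 z.line.rep) z.line), fun j k => by simp⟩
  else
    ⟨(h z.blowdown, lineThrough (h z.blowdown) z.line), lineThrough_mem _ _⟩

end

end BlowupModel

/-! ### Lifted charts -/

/-- `Φ` is a lift of the chart `φ` of `M` along `q : V → M`: a `C^∞` isomorphism (holomorphic if
`𝕜 = ℂ`) from `q ⁻¹' φ.source` onto the part of the model `X` lying over `φ.target`, which covers
`φ`. -/
structure IsChartLift {𝕜 : Type*} [RCLike 𝕜] {m : ℕ} {V M : Type*}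
    [TopologicalSpace V] [ChartedSpace (EuclideanSpace 𝕜 (Fin m)) V] [TopologicalSpace M]
    (q : V → M) (φ : OpenPartialHomeomorph M (EuclideanSpace 𝕜 (Fin m)))
    (Φ : OpenPartialHomeomorph V (BlowupModel 𝕜 m)) : Prop where
  source_eq : Φ.source = q ⁻¹' φ.source
  target_eq : Φ.target = BlowupModel.blowdown ⁻¹' φ.target
  contMDiffOn_toFun : ContMDiffOn 𝓘(𝕜, EuclideanSpace 𝕜 (Fin m))
    𝓘(𝕜, EuclideanSpace 𝕜 (Fin m)) ∞ Φ Φ.source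
  contMDiffOn_symm : ContMDiffOn 𝓘(𝕜, EuclideanSpace 𝕜 (Fin m))
    𝓘(𝕜, EuclideanSpace 𝕜 (Fin m)) ∞ Φ.symm Φ.target
  blowdown_comp : ∀ v ∈ Φ.source, (Φ v).blowdown = φ (q v)

end

/-!
As a set, the blowup is `M ∖ {p}` together with the projective space of the tangent space at `p`.
A chart `φ` centred at `p` identifies the part over its domain with the part of the model `X` over
its image, where the derivative of `φ` acts on the lines in the tangent space. Two such
identifications differ by the lift `ĥ` of a change of charts `h`, so they define the same manifold
structure once `ĥ` is known to be smooth. The only problem is at the exceptional locus, where one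
uses Hadamard's lemma: since `h 0 = 0`, there is a smooth family of linear maps `A` with
`h x = A x x` and `A 0 = Dh|₀`. Then `ĥ (μ y, [y]) = (μ v, [v])` with `v = A (μ y) y`, which is
smooth in `μ` and `y` because `v ≠ 0` near `μ = 0`. The blowdown map is a quotient map because the
exceptional locus is compact, so that each of its neighbourhoods contains the preimage of a
neighbourhood of `p`.
-/

noncomputable section

/-! ### Parametric integrals and Hadamard's lemma -/

section ParametricIntegral

variable {X 𝕜 E F : Type*} [TopologicalSpace X] [RCLike 𝕜] [NormedAddCommGroup E]
  [NormedSpace 𝕜 E] [NormedAddCommGroup F]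

theorem exists_eventually_forall_norm_le_of_continuousOn_prod {Y : Type*} [TopologicalSpace Y]
    {f : X → Y → F} {s : Set X} {K : Set Y} (hK : IsCompact K)
    (hf : ContinuousOn f.uncurry (s ×ˢ K)) {x : X} (hx : x ∈ s) :
    ∃ C, ∀ᶠ y in 𝓝[s] x, ∀ t ∈ K, ‖f y t‖ ≤ C := by
  obtain ⟨C, hC⟩ := hK.exists_bound_of_continuousOn (hf.uncurry_left x hx)
  obtain ⟨v, hv, hfv⟩ := hK.mem_uniformity_of_prod hf hx (Metric.dist_mem_uniformity one_pos)
  refine ⟨1 + C, Filter.mem_of_superset hv fun y hy t ht => ?_⟩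
  have hdist : ‖f y t - f x t‖ < 1 := by simpa [dist_eq_norm] using hfv y hy t ht
  linarith [norm_le_norm_sub_add (f y t) (f x t), hC t ht]

theorem intervalIntegrable_of_continuousOn_prod {f : X → ℝ → F} {s : Set X} {a b : ℝ}
    (hf : ContinuousOn f.uncurry (s ×ˢ uIcc a b)) {x : X} (hx : x ∈ s) :
    IntervalIntegrable (f x) MeasureTheory.volume a b :=
  (hf.uncurry_left x hx).intervalIntegrable

variable [NormedSpace ℝ F]

theorem continuousOn_intervalIntegral_of_continuousOn_prod [FirstCountableTopology X]
    {f : X → ℝ → F} {s : Set X} {a b : ℝ} (hf : ContinuousOn f.uncurry (s ×ˢ uIcc a b)) :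
    ContinuousOn (fun x => ∫ t in a..b, f x t) s := by
  intro x hx
  obtain ⟨C, hC⟩ := exists_eventually_forall_norm_le_of_continuousOn_prod isCompact_uIcc hf hx
  refine intervalIntegral.continuousWithinAt_of_dominated_interval (bound := fun _ => C) ?_ ?_
    (by simp) (.of_forall fun t ht => hf.uncurry_right t (uIoc_subset_uIcc ht) x hx)
  · filter_upwards [self_mem_nhdsWithin] with y hy
    exact (intervalIntegrable_of_continuousOn_prod hf hy).def'.aestronglyMeasurable
  · filter_upwards [hC] with y hy
    exact .of_forall fun t ht => hy t (uIoc_subset_uIcc ht)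

variable [NormedSpace 𝕜 F]

theorem hasFDerivAt_intervalIntegral_of_continuousOn_prod {f : E → ℝ → F}
    {f' : E → ℝ → E →L[𝕜] F} {s : Set E} (hs : IsOpen s) {a b : ℝ}
    (hf : ContinuousOn f.uncurry (s ×ˢ uIcc a b)) (hf' : ContinuousOn f'.uncurry (s ×ˢ uIcc a b))
    (hff' : ∀ t ∈ uIcc a b, ∀ x ∈ s, HasFDerivAt (f · t) (f' x t) x) {x : E} (hx : x ∈ s) :
    HasFDerivAt (fun x => ∫ t in a..b, f x t) (∫ t in a..b, f' x t) x := by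
  obtain ⟨C, hC⟩ := exists_eventually_forall_norm_le_of_continuousOn_prod isCompact_uIcc hf' hx
  rw [hs.nhdsWithin_eq hx] at hC
  have hsx := hs.mem_nhds hx
  refine intervalIntegral.hasFDerivAt_integral_of_dominated_of_fderiv_le (bound := fun _ => C)
    (Filter.inter_mem hC hsx) ?_ (intervalIntegrable_of_continuousOn_prod hf hx)
    (intervalIntegrable_of_continuousOn_prod hf' hx).def'.aestronglyMeasurable
    (.of_forall fun t ht y hy => hy.1 t (uIoc_subset_uIcc ht)) (by simp)
    (.of_forall fun t ht y hy => hff' t (uIoc_subset_uIcc ht) y hy.2)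
  filter_upwards [hsx] with y hy
  exact (intervalIntegrable_of_continuousOn_prod hf hy).def'.aestronglyMeasurable

variable [CompleteSpace F]

theorem hasFTaylorSeriesUpToOn_intervalIntegral {n : ℕ∞ω} {f : E → ℝ → F}
    {p : E → ℝ → FormalMultilinearSeries 𝕜 E F} {s : Set E} (hs : IsOpen s) {a b : ℝ}
    (hp : ∀ t ∈ uIcc a b, HasFTaylorSeriesUpToOn n (f · t) (p · t) s)
    (hcont : ∀ m : ℕ, m ≤ n → ContinuousOn (fun z : E × ℝ => p z.1 z.2 m) (s ×ˢ uIcc a b)) :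
    HasFTaylorSeriesUpToOn n (fun x => ∫ t in a..b, f x t) (fun x m => ∫ t in a..b, p x t m) s where
  zero_eq x hx := by
    have hcurry0 := LinearIsometry.intervalIntegral_comp_comm
      (continuousMultilinearCurryFin0 𝕜 E F).toLinearIsometry
      (a := a) (b := b) (μ := MeasureTheory.volume) fun t => p x t 0
    refine hcurry0.symm.trans (intervalIntegral.integral_congr fun t ht => ?_)
    exact (hp t ht).zero_eq x hx
  fderivWithin m hm x hx := by
    have hm' : ((m + 1 : ℕ) : ℕ∞ω) ≤ n := ENat.add_one_natCast_le_withTop_of_lt hm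
    let curryLeft : (E [×m + 1]→L[𝕜] F) ≃ₗᵢ[𝕜] (E →L[𝕜] E [×m]→L[𝕜] F) :=
      continuousMultilinearCurryLeftEquiv 𝕜 (fun _ => E) F
    have hderiv := hasFDerivAt_intervalIntegral_of_continuousOn_prod hs (f := fun x t => p x t m)
      (f' := fun x t => curryLeft (p x t (m + 1))) (hcont m hm.le)
      (curryLeft.continuous.comp_continuousOn (hcont _ hm'))
      (fun t ht y hy => ((hp t ht).fderivWithin m hm y hy).hasFDerivAt (hs.mem_nhds hy)) hx
    have hcurry := LinearIsometry.intervalIntegral_comp_comm (𝕜 := 𝕜)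
      (E := E [×m + 1]→L[𝕜] F) (F := E →L[𝕜] E [×m]→L[𝕜] F)
      curryLeft.toLinearIsometry (a := a) (b := b) (μ := MeasureTheory.volume)
      fun t => p x t (m + 1)
    exact (hderiv.congr_fderiv hcurry).hasFDerivWithinAt
  cont m hm := continuousOn_intervalIntegral_of_continuousOn_prod (f := fun x t => p x t m)
    (hcont m hm)

variable [NormedSpace ℝ E]

theorem continuousOn_comp_smul {G : Type*} [TopologicalSpace G] {g : E → G} {s : Set E}
    (hs : StarConvex ℝ 0 s) (hg : ContinuousOn g s) :
    ContinuousOn (fun z : E × ℝ => g (z.2 • z.1)) (s ×ˢ uIcc 0 1) :=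
  hg.comp (by fun_prop) fun z hz => by
    rw [uIcc_of_le zero_le_one] at hz
    exact hs.smul_mem hz.1 hz.2.1 hz.2.2

theorem contDiffOn_intervalIntegral_comp_smul {n : ℕ∞} {g : E → F} {s : Set E} (hs : IsOpen s)
    (hstar : StarConvex ℝ 0 s) (hg : ContDiffOn 𝕜 n g s) :
    ContDiffOn 𝕜 n (fun x => ∫ t in (0 : ℝ)..1, g (t • x)) s := by
  have hq := hg.ftaylorSeriesWithin hs.uniqueDiffOn
  set q := ftaylorSeriesWithin 𝕜 g s
  refine (hasFTaylorSeriesUpToOn_intervalIntegral hs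
    (p := fun x t m => (t : 𝕜) ^ m • q (t • x) m) (fun t ht => ?_) fun m hm => ?_).contDiffOn
  · rw [uIcc_of_le zero_le_one] at ht
    have hsmul (x : E) : ((t : 𝕜) • ContinuousLinearMap.id 𝕜 E) x = t • x :=
      (RCLike.real_smul_eq_coe_smul t x).symm
    have hcomp := (hq.compContinuousLinearMap ((t : 𝕜) • ContinuousLinearMap.id 𝕜 E)).mono
      (t := s) fun x hx => by
        rw [mem_preimage, hsmul]
        exact hstar.smul_mem hx ht.1 ht.2
    refine (hcomp.congr fun x _ => congr_arg g (hsmul x).symm).congr_series fun m _ x _ => ?_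
    refine ContinuousMultilinearMap.ext fun v => ?_
    simp only [hsmul, ContinuousMultilinearMap.compContinuousLinearMap_apply,
      smul_apply]
    simpa using ((q (t • x) m).map_smul_univ (fun _ => (t : 𝕜)) v)
  · exact (by fun_prop : Continuous fun z : E × ℝ => (z.2 : 𝕜) ^ m).continuousOn.smul
      (continuousOn_comp_smul hstar (hq.cont m hm))

theorem exists_contDiffOn_eq_apply_self {h : E → F} {s : Set E} (hs : IsOpen s)
    (hstar : StarConvex ℝ 0 s) (hh : ContDiffOn 𝕜 ∞ h s) (h0 : h 0 = 0) :
    ∃ A : E → E →L[𝕜] F, ContDiffOn 𝕜 ∞ A s ∧ A 0 = fderiv 𝕜 h 0 ∧ ∀ x ∈ s, h x = A x x := by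
  have hh' : ContDiffOn 𝕜 ∞ (fderiv 𝕜 h) s := hh.fderiv_of_isOpen hs (by simp)
  refine ⟨fun x => ∫ t in (0 : ℝ)..1, fderiv 𝕜 h (t • x),
    contDiffOn_intervalIntegral_comp_smul hs hstar hh', by simp, fun x hx => ?_⟩
  have hcont : ContinuousOn (fun t : ℝ => fderiv 𝕜 h (t • x)) (uIcc 0 1) :=
    ContinuousOn.uncurry_left (f := fun x (t : ℝ) => fderiv 𝕜 h (t • x)) x hx
      (continuousOn_comp_smul hstar hh'.continuousOn)
  have hderiv (t : ℝ) (ht : t ∈ uIcc 0 1) :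
      HasDerivAt (fun t : ℝ => h (t • x)) (fderiv 𝕜 h (t • x) x) t := by
    rw [uIcc_of_le zero_le_one] at ht
    have hdiff := ((hh.differentiableOn (by simp)).differentiableAt
      (hs.mem_nhds (hstar.smul_mem hx ht.1 ht.2))).hasFDerivAt.restrictScalars ℝ
    simpa [Function.comp_def] using hdiff.comp_hasDerivAt t ((hasDerivAt_id t).smul_const x)
  rw [ContinuousLinearMap.intervalIntegral_apply hcont.intervalIntegrable,
    intervalIntegral.integral_eq_sub_of_hasDerivAt hderiv
      (hcont.clm_apply continuousOn_const).intervalIntegrable]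
  simp [h0]

end ParametricIntegral

/-! ### Topology of projective spaces -/

section ProjectiveSpace

variable {𝕜 : Type*} [RCLike 𝕜]

theorem continuous_norm_inner_rep_div_norm_rep {W : Type*} [NormedAddCommGroup W]
    [InnerProductSpace 𝕜 W] (x : W) :
    Continuous fun l : ℙ 𝕜 W => ‖inner 𝕜 x l.rep‖ / ‖l.rep‖ := by
  rw [(Projectivization.isQuotientMap_mk' 𝕜 W).continuous_iff]
  have hcont : Continuous fun y : {y : W // y ≠ 0} => ‖inner 𝕜 x (y : W)‖ / ‖(y : W)‖ :=
    Continuous.div (by fun_prop) (by fun_prop) fun y => norm_ne_zero_iff.2 y.2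
  refine hcont.congr fun y => ?_
  obtain ⟨a, ha⟩ := Projectivization.exists_smul_eq_mk_rep 𝕜 y.1 y.2
  have hrep : (Projectivization.mk' 𝕜 y).rep = (a : 𝕜) • (y : W) := ha.symm
  simp only [Function.comp_apply, hrep, inner_smul_right, norm_mul, norm_smul]
  rw [mul_div_mul_left _ _ (norm_ne_zero_iff.2 a.ne_zero)]

instance {W : Type*} [NormedAddCommGroup W] [InnerProductSpace 𝕜 W] : T2Space (ℙ 𝕜 W) where
  t2 l l' hl := by
    refine separated_by_continuous (continuous_norm_inner_rep_div_norm_rep l.rep) fun h => hl ?_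
    have hl0 : ‖l.rep‖ ≠ 0 := norm_ne_zero_iff.2 l.rep_nonzero
    have hl0' : ‖l'.rep‖ ≠ 0 := norm_ne_zero_iff.2 l'.rep_nonzero
    -- equality case of the Cauchy–Schwarz inequality
    have hCS : ‖inner 𝕜 l.rep l'.rep‖ = ‖l.rep‖ * ‖l'.rep‖ := by
      have hself : ‖inner 𝕜 l.rep l.rep‖ = ‖l.rep‖ * ‖l.rep‖ := by
        rw [inner_self_eq_norm_sq_to_K]; simp [sq]
      rw [hself, mul_div_cancel_right₀ _ hl0, eq_div_iff hl0'] at h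
      exact h.symm
    obtain ⟨a, -, h⟩ := (norm_inner_eq_norm_iff l.rep_nonzero l'.rep_nonzero).1 hCS
    rw [← l.mk_rep, ← l'.mk_rep, eq_comm, Projectivization.mk_eq_mk_iff']
    exact ⟨a, h.symm⟩

instance {W : Type*} [NormedAddCommGroup W] [NormedSpace 𝕜 W] [ProperSpace W] :
    CompactSpace (ℙ 𝕜 W) := by
  have hne (y : Metric.sphere (0 : W) 1) : (y : W) ≠ 0 := ne_zero_of_mem_unit_sphere y
  have hsurj : Function.Surjective fun y : Metric.sphere (0 : W) 1 =>
      Projectivization.mk 𝕜 (y : W) (hne y) := by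
    intro l
    have hl : ‖l.rep‖ ≠ 0 := norm_ne_zero_iff.2 l.rep_nonzero
    refine ⟨⟨(‖l.rep‖⁻¹ : 𝕜) • l.rep, by simp [norm_smul, hl]⟩, ?_⟩
    conv_rhs => rw [← l.mk_rep]
    exact (Projectivization.mk_eq_mk_iff' 𝕜 _ _ _ _).2 ⟨_, rfl⟩
  have hcont : Continuous fun y : Metric.sphere (0 : W) 1 =>
      Projectivization.mk 𝕜 (y : W) (hne y) :=
    (Projectivization.isQuotientMap_mk' 𝕜 W).continuous.comp
      (continuous_subtype_val.subtype_mk hne)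
  exact hsurj.compactSpace hcont

instance {W : Type*} [NormedAddCommGroup W] [NormedSpace 𝕜 W] [Nontrivial W] :
    ConnectedSpace (ℙ 𝕜 W) where
  toNonempty := inferInstance
  isPreconnected_univ := by
    refine isPreconnected_of_forall_pair fun l _ l' _ => ?_
    obtain rfl | hl := eq_or_ne l l'
    · exact ⟨{l}, subset_univ _, rfl, rfl, isPreconnected_singleton⟩
    have hind : LinearIndependent 𝕜 ![l.rep, l'.rep] := by
      rwa [← Projectivization.independent_mk_iff_LinearIndependent l.rep_nonzero l'.rep_nonzero,
        l.mk_rep, l'.mk_rep, Projectivization.independent_pair_iff_ne]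
    have hne (t : 𝕜) : (1 - t) • l.rep + t • l'.rep ≠ 0 := fun h0 => by
      obtain ⟨h1, h2⟩ := LinearIndependent.pair_iff.1 hind _ _ h0
      simp [h2] at h1
    have hcont : Continuous fun t : 𝕜 => Projectivization.mk 𝕜 _ (hne t) :=
      (Projectivization.isQuotientMap_mk' 𝕜 W).continuous.comp
        ((by fun_prop : Continuous fun t : 𝕜 => (1 - t) • l.rep + t • l'.rep).subtype_mk hne)
    exact ⟨range _, subset_univ _, ⟨0, by simp⟩, ⟨1, by simp⟩, isPreconnected_range hcont⟩

end ProjectiveSpace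

/-! ### Geometry of the model blowup -/

namespace BlowupModel

open Projectivization

variable {𝕜 : Type*} [RCLike 𝕜] {m : ℕ}

theorem ext {z z' : BlowupModel 𝕜 m} (h : z.blowdown = z'.blowdown) (h' : z.line = z'.line) :
    z = z' :=
  Subtype.ext (Prod.ext h h')

instance : T2Space (BlowupModel 𝕜 m) := inferInstanceAs (T2Space (Subtype _))

instance : SecondCountableTopology (BlowupModel 𝕜 m) := by
  have (j : Fin m) : SecondCountableTopology (chart 𝕜 m j).source :=
    (chart 𝕜 m j).secondCountableTopology_source
  exact TopologicalSpace.secondCountableTopology_of_countable_cover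
    (fun j => (chart 𝕜 m j).open_source)
    (eq_univ_of_forall fun z => mem_iUnion.2 (exists_rep_ne_zero z.line))

theorem exists_apply_ne_zero {x : EuclideanSpace 𝕜 (Fin m)} (hx : x ≠ 0) : ∃ j, x j ≠ 0 := by
  by_contra! h
  exact hx (by ext j; simpa using h j)

theorem line_eq_mk {z : BlowupModel 𝕜 m} (hz : z.blowdown ≠ 0) :
    z.line = mk 𝕜 z.blowdown hz := by
  obtain ⟨j, hj⟩ := exists_apply_ne_zero hz
  conv_lhs => rw [← z.line.mk_rep]
  refine (mk_eq_mk_iff' 𝕜 _ _ _ _).2 ⟨z.line.rep j / z.blowdown j, ?_⟩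
  ext i
  have hij : z.blowdown i * z.line.rep j = z.blowdown j * z.line.rep i := z.2 i j
  rw [PiLp.smul_apply, smul_eq_mul, div_mul_eq_mul_div, div_eq_iff hj]
  linear_combination hij

theorem eq_of_blowdown_eq {z z' : BlowupModel 𝕜 m} (hz : z.blowdown ≠ 0)
    (h : z.blowdown = z'.blowdown) : z = z' := by
  refine ext h ?_
  rw [line_eq_mk hz, line_eq_mk (h ▸ hz)]
  congr 1

theorem chart_apply_ofSMul (μ : 𝕜) {y : EuclideanSpace 𝕜 (Fin m)} (hy : y ≠ 0) (k : Fin m) :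
    chart 𝕜 m k (ofSMul μ y hy) =
      WithLp.toLp 2 fun i => if i = k then μ * y k else y i / y k := by
  ext i
  change (if i = k then μ * y k else (mk 𝕜 y hy).rep i / (mk 𝕜 y hy).rep k) = _
  rw [rep_mk_div]

theorem eq_ofSMul {j : Fin m} {z : BlowupModel 𝕜 m} (hz : z ∈ (chart 𝕜 m j).source) :
    z = ofSMul (chart 𝕜 m j z j) (replaceOne j (chart 𝕜 m j z)) (replaceOne_ne_zero _ _) :=
  ((chart 𝕜 m j).left_inv hz).symm

theorem chart_mem_maximalAtlas (j : Fin m) :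
    chart 𝕜 m j ∈ IsManifold.maximalAtlas 𝓘(𝕜, EuclideanSpace 𝕜 (Fin m)) ∞
      (BlowupModel 𝕜 m) :=
  IsManifold.subset_maximalAtlas (mem_range_self j)

theorem contMDiffAt_of_eventually_eq_ofSMul {E H N : Type*} [NormedAddCommGroup E]
    [NormedSpace 𝕜 E] [TopologicalSpace H] {I : ModelWithCorners 𝕜 E H} [TopologicalSpace N]
    [ChartedSpace H N] {f : N → BlowupModel 𝕜 m} {μ : N → 𝕜}
    {v : N → EuclideanSpace 𝕜 (Fin m)} {a : N} (hμ : ContMDiffAt I 𝓘(𝕜, 𝕜) ∞ μ a)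
    (hv : ContMDiffAt I 𝓘(𝕜, EuclideanSpace 𝕜 (Fin m)) ∞ v a) (hva : v a ≠ 0)
    (hf : ∀ᶠ b in 𝓝 a, ∀ hb : v b ≠ 0, f b = ofSMul (μ b) (v b) hb) :
    ContMDiffAt I 𝓘(𝕜, EuclideanSpace 𝕜 (Fin m)) ∞ f a := by
  obtain ⟨k, hk⟩ := exists_apply_ne_zero hva
  have hcoord (i : Fin m) : ContDiff 𝕜 ∞ fun w : 𝕜 × EuclideanSpace 𝕜 (Fin m) => w.2 i :=
    (contDiff_euclidean.1 contDiff_id i).comp contDiff_snd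
  have hg : ContDiffAt 𝕜 ∞ (fun w : 𝕜 × EuclideanSpace 𝕜 (Fin m) =>
      WithLp.toLp 2 fun i => if i = k then w.1 * w.2 k else w.2 i / w.2 k) (μ a, v a) := by
    rw [contDiffAt_euclidean]
    intro i
    by_cases hi : i = k
    · simpa only [hi, if_true] using (contDiff_fst.mul (hcoord k)).contDiffAt
    · simp only [hi, if_false]
      exact (hcoord i).contDiffAt.div (hcoord k).contDiffAt hk
  refine ((contMDiffAt_symm_of_mem_maximalAtlas (chart_mem_maximalAtlas k) (mem_univ _)).comp a
    (hg.contMDiffAt.comp a (hμ.prodMk_space hv))).congr_of_eventuallyEq ?_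
  have hvk : ∀ᶠ b in 𝓝 a, v b k ≠ 0 :=
    ((hcoord k).continuous.comp (by fun_prop : Continuous fun x => ((0 : 𝕜), x))
      |>.continuousAt.comp hv.continuousAt).eventually_ne hk
  filter_upwards [hf, hvk] with b hfb hbk
  have hb : v b ≠ 0 := fun h => hbk (by simp [h])
  have hs : f b ∈ (chart 𝕜 m k).source := hfb hb ▸ (rep_mk_ne_zero_iff _ hb k).2 hbk
  rw [← (chart 𝕜 m k).left_inv hs, hfb hb, chart_apply_ofSMul]
  rfl

theorem contMDiff_blowdown :
    ContMDiff 𝓘(𝕜, EuclideanSpace 𝕜 (Fin m)) 𝓘(𝕜, EuclideanSpace 𝕜 (Fin m)) ∞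
      (blowdown : BlowupModel 𝕜 m → _) := by
  intro z
  obtain ⟨j, hj⟩ := exists_rep_ne_zero z.line
  have hg : ContDiff 𝕜 ∞ fun w : EuclideanSpace 𝕜 (Fin m) => w j • replaceOne j w :=
    (contDiff_euclidean.1 contDiff_id j : ContDiff 𝕜 ∞ fun w => w j).smul
      (contDiff_replaceOne j ∞)
  refine (hg.contMDiff.contMDiffAt.comp z (contMDiffAt_of_mem_maximalAtlas
    (chart_mem_maximalAtlas j) hj)).congr_of_eventuallyEq ?_
  filter_upwards [(chart 𝕜 m j).open_source.mem_nhds hj] with z' hz'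
  exact congrArg blowdown (eq_ofSMul hz')

/-- The inverse of the blowdown map away from the origin, with an arbitrary value over `0`. -/
def blowdownInv [NeZero m] (x : EuclideanSpace 𝕜 (Fin m)) : BlowupModel 𝕜 m :=
  ⟨(x, lineThrough x (Classical.arbitrary _)), lineThrough_mem _ _⟩

theorem blowdownInv_blowdown [NeZero m] {z : BlowupModel 𝕜 m} (hz : z.blowdown ≠ 0) :
    blowdownInv z.blowdown = z :=
  (eq_of_blowdown_eq (z' := blowdownInv z.blowdown) hz rfl).symm

theorem contMDiffAt_blowdownInv [NeZero m] {x : EuclideanSpace 𝕜 (Fin m)} (hx : x ≠ 0) :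
    ContMDiffAt 𝓘(𝕜, EuclideanSpace 𝕜 (Fin m)) 𝓘(𝕜, EuclideanSpace 𝕜 (Fin m)) ∞
      (blowdownInv (𝕜 := 𝕜)) x :=
  contMDiffAt_of_eventually_eq_ofSMul contMDiffAt_const contMDiffAt_id hx
    (.of_forall fun _ hy => eq_of_blowdown_eq hy (one_smul 𝕜 _).symm)

/-- The inclusion `l ↦ (0, l)` of the exceptional locus. -/
def zeroSection (l : ℙ 𝕜 (EuclideanSpace 𝕜 (Fin m))) : BlowupModel 𝕜 m :=
  ⟨(0, l), fun j k => by simp⟩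

@[simp] theorem blowdown_zeroSection (l : ℙ 𝕜 (EuclideanSpace 𝕜 (Fin m))) :
    (zeroSection l).blowdown = 0 := rfl

@[simp] theorem line_zeroSection (l : ℙ 𝕜 (EuclideanSpace 𝕜 (Fin m))) :
    (zeroSection l).line = l := rfl

theorem zeroSection_line {z : BlowupModel 𝕜 m} (hz : z.blowdown = 0) : zeroSection z.line = z :=
  ext hz.symm rfl

theorem continuous_zeroSection :
    Continuous (zeroSection : ℙ 𝕜 (EuclideanSpace 𝕜 (Fin m)) → BlowupModel 𝕜 m) :=
  Continuous.subtype_mk (by fun_prop) _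

theorem eventually_forall_mem_of_isOpen {W : Set (BlowupModel 𝕜 m)} (hW : IsOpen W)
    (h0 : ∀ z : BlowupModel 𝕜 m, z.blowdown = 0 → z ∈ W) :
    ∀ᶠ x in 𝓝 (0 : EuclideanSpace 𝕜 (Fin m)), ∀ z : BlowupModel 𝕜 m, z.blowdown = x → z ∈ W := by
  obtain ⟨W', hW', rfl⟩ := isOpen_induced_iff.1 hW
  have htube : ∀ᶠ x in 𝓝 (0 : EuclideanSpace 𝕜 (Fin m)),
      ∀ l ∈ (univ : Set (ℙ 𝕜 (EuclideanSpace 𝕜 (Fin m)))), (x, l) ∈ W' :=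
    isCompact_univ.eventually_forall_of_forall_eventually fun l _ =>
      hW'.mem_nhds (h0 (zeroSection l) rfl)
  filter_upwards [htube] with x hx z hz
  subst hz
  exact hx z.line (mem_univ _)

theorem lineThrough_of_ne_zero {v : EuclideanSpace 𝕜 (Fin m)} (hv : v ≠ 0)
    (l : ℙ 𝕜 (EuclideanSpace 𝕜 (Fin m))) : lineThrough v l = mk 𝕜 v hv := dif_neg hv

theorem lift_zeroSection {h : EuclideanSpace 𝕜 (Fin m) → EuclideanSpace 𝕜 (Fin m)}
    (hi : Function.Injective (fderiv 𝕜 h 0)) (l : ℙ 𝕜 (EuclideanSpace 𝕜 (Fin m))) :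
    lift h (zeroSection l) =
      zeroSection (Projectivization.map (fderiv 𝕜 h 0).toLinearMap hi l) := by
  have hl : fderiv 𝕜 h 0 l.rep ≠ 0 := (map_ne_zero_iff _ hi).2 l.rep_nonzero
  refine (if_pos rfl).trans (ext rfl ?_)
  change lineThrough (fderiv 𝕜 h 0 l.rep) l = _
  conv_rhs => rw [← l.mk_rep]
  rw [lineThrough_of_ne_zero hl]
  rfl

theorem blowdown_lift {h : EuclideanSpace 𝕜 (Fin m) → EuclideanSpace 𝕜 (Fin m)} (h0 : h 0 = 0)
    (z : BlowupModel 𝕜 m) : (lift h z).blowdown = h z.blowdown := by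
  by_cases hz : z.blowdown = 0
  · rw [hz, h0]
    exact congrArg blowdown (if_pos hz)
  · exact congrArg blowdown (if_neg hz)

theorem lift_ofSMul {h : EuclideanSpace 𝕜 (Fin m) → EuclideanSpace 𝕜 (Fin m)} (h0 : h 0 = 0)
    (hi : Function.Injective (fderiv 𝕜 h 0)) {μ : 𝕜} {y v : EuclideanSpace 𝕜 (Fin m)} (hy : y ≠ 0)
    (hv : v ≠ 0) (hμ : h (μ • y) = μ • v) (hμ0 : μ = 0 → fderiv 𝕜 h 0 y = v) :
    lift h (ofSMul μ y hy) = ofSMul μ v hv := by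
  obtain rfl | hμ' := eq_or_ne μ 0
  · obtain rfl := hμ0 rfl
    have hzero (w : EuclideanSpace 𝕜 (Fin m)) (hw : w ≠ 0) :
        ofSMul 0 w hw = zeroSection (mk 𝕜 w hw) := ext (zero_smul 𝕜 w) rfl
    rw [hzero, hzero, lift_zeroSection hi]
    rfl
  · have hb : (lift h (ofSMul μ y hy)).blowdown = μ • v := (blowdown_lift h0 _).trans hμ
    exact eq_of_blowdown_eq (hb ▸ smul_ne_zero hμ' hv) hb

theorem contMDiffAt_lift_of_blowdown_eq_zero {r : ℝ} (hr : 0 < r)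
    {h : EuclideanSpace 𝕜 (Fin m) → EuclideanSpace 𝕜 (Fin m)}
    (hh : ContDiffOn 𝕜 ∞ h (Metric.ball 0 r)) (h0 : h 0 = 0)
    (hi : Function.Injective (fderiv 𝕜 h 0)) {z : BlowupModel 𝕜 m} (hz : z.blowdown = 0) :
    ContMDiffAt 𝓘(𝕜, EuclideanSpace 𝕜 (Fin m)) 𝓘(𝕜, EuclideanSpace 𝕜 (Fin m)) ∞ (lift h) z := by
  obtain ⟨A, hA, hA0, hAh⟩ := exists_contDiffOn_eq_apply_self Metric.isOpen_ball
    ((convex_ball (0 : EuclideanSpace 𝕜 (Fin m)) r).starConvex (Metric.mem_ball_self hr)) hh h0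
  obtain ⟨j, hj⟩ := exists_rep_ne_zero z.line
  have hball : Metric.ball (0 : EuclideanSpace 𝕜 (Fin m)) r ∈ 𝓝 z.blowdown :=
    hz ▸ Metric.ball_mem_nhds _ hr
  have hchart := contMDiffAt_of_mem_maximalAtlas (chart_mem_maximalAtlas (𝕜 := 𝕜) j) hj
  have hμ : ContMDiffAt 𝓘(𝕜, EuclideanSpace 𝕜 (Fin m)) 𝓘(𝕜, 𝕜) ∞
      (fun z' => chart 𝕜 m j z' j) z :=
    ContMDiffAt.comp (g := fun w : EuclideanSpace 𝕜 (Fin m) => w j) z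
      (contDiff_euclidean.1 contDiff_id j).contMDiff.contMDiffAt hchart
  have hv : ContMDiffAt 𝓘(𝕜, EuclideanSpace 𝕜 (Fin m)) 𝓘(𝕜, EuclideanSpace 𝕜 (Fin m)) ∞
      (fun z' => A z'.blowdown (replaceOne j (chart 𝕜 m j z'))) z :=
    ((hA.contDiffAt hball).contMDiffAt.comp z contMDiff_blowdown.contMDiffAt).clm_apply
      ((contDiff_replaceOne j ∞).contMDiff.contMDiffAt.comp z hchart)
  have hv0 : A z.blowdown (replaceOne j (chart 𝕜 m j z)) ≠ 0 := by
    rw [hz, hA0]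
    exact (map_ne_zero_iff _ hi).2 (replaceOne_ne_zero _ _)
  refine contMDiffAt_of_eventually_eq_ofSMul hμ hv hv0 ?_
  filter_upwards [(chart 𝕜 m j).open_source.mem_nhds hj,
    continuous_blowdown.continuousAt.preimage_mem_nhds hball] with z' hz' hzb hv'
  have hb : z'.blowdown = chart 𝕜 m j z' j • replaceOne j (chart 𝕜 m j z') :=
    congrArg blowdown (eq_ofSMul hz')
  conv_lhs => rw [eq_ofSMul hz']
  refine lift_ofSMul h0 hi _ hv' ?_ fun hμ0 => ?_
  · rw [← hb, hAh _ hzb, ← map_smul, ← hb]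
  · rw [hb, hμ0, zero_smul, hA0]

theorem contMDiffOn_lift {h : EuclideanSpace 𝕜 (Fin m) → EuclideanSpace 𝕜 (Fin m)}
    {s : Set (EuclideanSpace 𝕜 (Fin m))} (hs : IsOpen s) (hh : ContDiffOn 𝕜 ∞ h s)
    (h0 : h 0 = 0) (hi : Function.Injective (fderiv 𝕜 h 0)) (hne : ∀ x ∈ s, h x = 0 → x = 0) :
    ContMDiffOn 𝓘(𝕜, EuclideanSpace 𝕜 (Fin m)) 𝓘(𝕜, EuclideanSpace 𝕜 (Fin m)) ∞ (lift h)
      (blowdown ⁻¹' s) := by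
  intro z hz
  refine ContMDiffAt.contMDiffWithinAt ?_
  by_cases hz0 : z.blowdown = 0
  · obtain ⟨r, hr, hball⟩ := Metric.isOpen_iff.1 hs 0 (hz0 ▸ hz)
    exact contMDiffAt_lift_of_blowdown_eq_zero hr (hh.mono hball) h0 hi hz0
  · refine contMDiffAt_of_eventually_eq_ofSMul (μ := fun _ => 1) contMDiffAt_const
      ((hh.contDiffAt (hs.mem_nhds hz)).contMDiffAt.comp z contMDiff_blowdown.contMDiffAt)
      (fun h0' => hz0 (hne _ hz h0')) (.of_forall fun z' hz' => ?_)
    have hb : (lift h z').blowdown = h z'.blowdown := blowdown_lift h0 z'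
    exact eq_of_blowdown_eq (hb ▸ hz') (hb.trans (one_smul 𝕜 _).symm)

end BlowupModel

/-! ### Partial maps which are smooth on an open source -/

section SmoothOnSource

variable {𝕜 E H : Type*} [NontriviallyNormedField 𝕜] [NormedAddCommGroup E] [NormedSpace 𝕜 E]
  [TopologicalSpace H] {I : ModelWithCorners 𝕜 E H} {n : ℕ∞ω}
  {N N' N'' : Type*} [TopologicalSpace N] [ChartedSpace H N] [TopologicalSpace N']
  [ChartedSpace H N'] [TopologicalSpace N''] [ChartedSpace H N'']

variable (I n) in
/-- The partial map underlying `g` is `C^n`, on an open source. Nothing is required of `g.symm`, so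
that this makes sense for the two halves of a coordinate change separately. -/
structure IsSmoothOnSource (g : PartialEquiv N N') : Prop where
  isOpen_source : IsOpen g.source
  contMDiffOn : ContMDiffOn I I n g g.source

namespace IsSmoothOnSource

theorem trans {g : PartialEquiv N N'} {g' : PartialEquiv N' N''} (hg : IsSmoothOnSource I n g)
    (hg' : IsSmoothOnSource I n g') : IsSmoothOnSource I n (g.trans g') where
  isOpen_source :=
    hg.contMDiffOn.continuousOn.isOpen_inter_preimage hg.isOpen_source hg'.isOpen_source
  contMDiffOn := hg'.contMDiffOn.comp (hg.contMDiffOn.mono inter_subset_left) inter_subset_right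

theorem of_forall_exists {g : PartialEquiv N N'}
    (h : ∀ a ∈ g.source, ∃ g' : PartialEquiv N N', IsSmoothOnSource I n g' ∧ a ∈ g'.source ∧
      g'.source ⊆ g.source ∧ EqOn g g' g'.source) : IsSmoothOnSource I n g where
  isOpen_source := isOpen_iff_mem_nhds.2 fun a ha => by
    obtain ⟨g', hg', hag', hsub, -⟩ := h a ha
    exact Filter.mem_of_superset (hg'.isOpen_source.mem_nhds hag') hsub
  contMDiffOn a ha := by
    obtain ⟨g', hg', hag', -, heq⟩ := h a ha
    have hnhds := hg'.isOpen_source.mem_nhds hag'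
    exact ((hg'.contMDiffOn.contMDiffAt hnhds).congr_of_eventuallyEq
      (heq.eventuallyEq_of_mem hnhds)).contMDiffWithinAt

theorem of_mem_maximalAtlas {c : OpenPartialHomeomorph N H}
    (hc : c ∈ IsManifold.maximalAtlas I n N) : IsSmoothOnSource I n c.toPartialEquiv :=
  ⟨c.open_source, contMDiffOn_of_mem_maximalAtlas hc⟩

theorem symm_of_mem_maximalAtlas {c : OpenPartialHomeomorph N H}
    (hc : c ∈ IsManifold.maximalAtlas I n N) : IsSmoothOnSource I n c.toPartialEquiv.symm :=
  ⟨c.open_target, contMDiffOn_symm_of_mem_maximalAtlas hc⟩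

theorem of_chartAt_symm_trans [IsManifold I n N] {g : PartialEquiv N N'}
    (h : ∀ a, IsSmoothOnSource I n ((chartAt H a).toPartialEquiv.symm.trans g)) :
    IsSmoothOnSource I n g := by
  refine of_forall_exists fun a ha => ⟨(chartAt H a).toPartialEquiv.trans
    ((chartAt H a).toPartialEquiv.symm.trans g),
    (of_mem_maximalAtlas (IsManifold.chart_mem_maximalAtlas a)).trans (h a), ?_, ?_, ?_⟩
  · simp [ha]
  · intro b hb
    simp only [mfld_simps] at hb
    simpa only [hb.1, mfld_simps] using hb.2.2
  · intro b hb
    simp only [mfld_simps] at hb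
    simp [hb]

theorem of_trans_chartAt [IsManifold I n N'] {g : PartialEquiv N N'}
    (h : ∀ b, IsSmoothOnSource I n (g.trans (chartAt H b).toPartialEquiv)) :
    IsSmoothOnSource I n g := by
  refine of_forall_exists fun a ha => ⟨(g.trans (chartAt H (g a)).toPartialEquiv).trans
    (chartAt H (g a)).toPartialEquiv.symm,
    (h (g a)).trans (symm_of_mem_maximalAtlas (IsManifold.chart_mem_maximalAtlas _)), ?_, ?_, ?_⟩
  · simp [ha]
  · intro b hb
    simp only [mfld_simps] at hb
    exact hb.1.1
  · intro b hb
    simp only [mfld_simps] at hb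
    simp [hb]

/-- An equivalence between open sets which is smooth in both directions, as an open partial
homeomorphism. -/
def toOpenPartialHomeomorph {g : PartialEquiv N N'} (hg : IsSmoothOnSource I n g)
    (hg' : IsSmoothOnSource I n g.symm) : OpenPartialHomeomorph N N' where
  toPartialEquiv := g
  open_source := hg.isOpen_source
  open_target := hg'.isOpen_source
  continuousOn_toFun := hg.contMDiffOn.continuousOn
  continuousOn_invFun := hg'.contMDiffOn.continuousOn

end IsSmoothOnSource

end SmoothOnSource

/-! ### Charts centred at a point -/

/-- The bijection of projective spaces induced by a linear equivalence. -/
def projectivizationEquiv {K V W : Type*} [DivisionRing K] [AddCommGroup V] [Module K V]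
    [AddCommGroup W] [Module K W] (D : V ≃ₗ[K] W) : ℙ K V ≃ ℙ K W where
  toFun := Projectivization.map D.toLinearMap D.injective
  invFun := Projectivization.map D.symm.toLinearMap D.symm.injective
  left_inv l := by
    induction l using Projectivization.ind with | h v hv => simp [Projectivization.map_mk]
  right_inv l := by
    induction l using Projectivization.ind with | h v hv => simp [Projectivization.map_mk]

section

variable {𝕜 : Type v} [RCLike 𝕜] {m : ℕ} {M : Type u} [TopologicalSpace M]
  [ChartedSpace (EuclideanSpace 𝕜 (Fin m)) M]

/-- A chart of the maximal atlas of `M` which is defined at `p` and maps it to `0`. -/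
structure IsCentredChart (p : M) (φ : OpenPartialHomeomorph M (EuclideanSpace 𝕜 (Fin m))) :
    Prop where
  mem_maximalAtlas : φ ∈ IsManifold.maximalAtlas 𝓘(𝕜, EuclideanSpace 𝕜 (Fin m)) ∞ M
  mem_source : p ∈ φ.source
  map_eq_zero : φ p = 0

variable (𝕜 m) in
theorem exists_isCentredChart [IsManifold 𝓘(𝕜, EuclideanSpace 𝕜 (Fin m)) ∞ M] (p : M) :
    ∃ φ : OpenPartialHomeomorph M (EuclideanSpace 𝕜 (Fin m)), IsCentredChart p φ := by
  set c := chartAt (EuclideanSpace 𝕜 (Fin m)) p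
  have hc : c ∈ IsManifold.maximalAtlas 𝓘(𝕜, EuclideanSpace 𝕜 (Fin m)) ∞ M :=
    IsManifold.chart_mem_maximalAtlas p
  refine ⟨c.transHomeomorph (Homeomorph.subRight (c p)),
    OpenPartialHomeomorph.mem_maximalAtlas_of_contMDiffOn _ ?_ ?_, mem_chart_source _ p, ?_⟩
  · exact (contDiff_id.sub contDiff_const).contMDiff.comp_contMDiffOn
      (contMDiffOn_of_mem_maximalAtlas hc)
  · refine (contMDiffOn_symm_of_mem_maximalAtlas hc).comp
      (contDiff_id.add contDiff_const).contMDiff.contMDiffOn fun x hx => ?_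
    simpa [sub_eq_add_neg] using hx
  · simp

namespace IsCentredChart

variable {p : M} {φ ψ : OpenPartialHomeomorph M (EuclideanSpace 𝕜 (Fin m))}

theorem zero_mem_target (hφ : IsCentredChart p φ) : (0 : EuclideanSpace 𝕜 (Fin m)) ∈ φ.target :=
  hφ.map_eq_zero ▸ φ.map_source hφ.mem_source

theorem symm_zero (hφ : IsCentredChart p φ) : φ.symm 0 = p := by
  rw [← hφ.map_eq_zero, φ.left_inv hφ.mem_source]

theorem apply_ne_zero (hφ : IsCentredChart p φ) {a : M} (ha : a ∈ φ.source) (hap : a ≠ p) :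
    φ a ≠ 0 := fun h => hap (by rw [← φ.left_inv ha, h, hφ.symm_zero])

theorem symm_apply_ne (hφ : IsCentredChart p φ) {x : EuclideanSpace 𝕜 (Fin m)}
    (hx : x ∈ φ.target) (hx0 : x ≠ 0) : φ.symm x ≠ p :=
  fun h => hx0 (by rw [← φ.right_inv hx, h, hφ.map_eq_zero])

theorem mdifferentiable (hφ : IsCentredChart p φ) :
    φ.MDifferentiable 𝓘(𝕜, EuclideanSpace 𝕜 (Fin m)) 𝓘(𝕜, EuclideanSpace 𝕜 (Fin m)) :=
  ⟨(contMDiffOn_of_mem_maximalAtlas hφ.mem_maximalAtlas).mdifferentiableOn (by simp),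
    (contMDiffOn_symm_of_mem_maximalAtlas hφ.mem_maximalAtlas).mdifferentiableOn (by simp)⟩

/-- The derivative at `p` of a centred chart. -/
def tangentEquiv (hφ : IsCentredChart p φ) :
    TangentSpace 𝓘(𝕜, EuclideanSpace 𝕜 (Fin m)) p ≃L[𝕜] EuclideanSpace 𝕜 (Fin m) :=
  hφ.mdifferentiable.mfderiv hφ.mem_source

theorem zero_mem_source_transition (hφ : IsCentredChart p φ) (hψ : IsCentredChart p ψ) :
    (0 : EuclideanSpace 𝕜 (Fin m)) ∈ (φ.symm.trans ψ).source :=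
  ⟨hφ.zero_mem_target, by simpa [hφ.symm_zero] using hψ.mem_source⟩

theorem transition_zero (hφ : IsCentredChart p φ) (hψ : IsCentredChart p ψ) :
    (ψ ∘ φ.symm) 0 = 0 := by
  simp [hφ.symm_zero, hψ.map_eq_zero]

theorem contDiffOn_transition (hφ : IsCentredChart p φ) (hψ : IsCentredChart p ψ) :
    ContDiffOn 𝕜 ∞ (ψ ∘ φ.symm) (φ.symm.trans ψ).source := by
  rw [← contMDiffOn_iff_contDiffOn]
  exact (contMDiffOn_of_mem_maximalAtlas hψ.mem_maximalAtlas).comp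
    ((contMDiffOn_symm_of_mem_maximalAtlas hφ.mem_maximalAtlas).mono inter_subset_left)
    inter_subset_right

theorem fderiv_transition_tangentEquiv (hφ : IsCentredChart p φ) (hψ : IsCentredChart p ψ)
    (w : TangentSpace 𝓘(𝕜, EuclideanSpace 𝕜 (Fin m)) p) :
    fderiv 𝕜 (ψ ∘ φ.symm) 0 (hφ.tangentEquiv w) = hψ.tangentEquiv w := by
  have hdiff : MDifferentiableAt 𝓘(𝕜, EuclideanSpace 𝕜 (Fin m)) 𝓘(𝕜, EuclideanSpace 𝕜 (Fin m))
      (ψ ∘ φ.symm) (φ p) :=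
    (((hφ.contDiffOn_transition hψ).contDiffAt ((φ.symm.trans ψ).open_source.mem_nhds
      (hφ.map_eq_zero ▸ hφ.zero_mem_source_transition hψ))).differentiableAt
        (by simp)).mdifferentiableAt
  have hcongr : (ψ ∘ φ.symm) ∘ φ =ᶠ[𝓝 p] ψ := by
    filter_upwards [φ.open_source.mem_nhds hφ.mem_source] with a ha
    simp [φ.left_inv ha]
  have hchain := hcongr.mfderiv_eq (I := 𝓘(𝕜, EuclideanSpace 𝕜 (Fin m)))
    (I' := 𝓘(𝕜, EuclideanSpace 𝕜 (Fin m)))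
  rw [mfderiv_comp p hdiff (hφ.mdifferentiable.mdifferentiableAt hφ.mem_source),
    mfderiv_eq_fderiv] at hchain
  rw [← hφ.map_eq_zero]
  exact DFunLike.congr_fun hchain w

theorem injective_fderiv_transition (hφ : IsCentredChart p φ) (hψ : IsCentredChart p ψ) :
    Function.Injective (fderiv 𝕜 (ψ ∘ φ.symm) 0) := by
  have h : ⇑(fderiv 𝕜 (ψ ∘ φ.symm) 0) ∘ hφ.tangentEquiv = hψ.tangentEquiv :=
    funext (hφ.fderiv_transition_tangentEquiv hψ)
  exact Function.Injective.of_comp_right (h ▸ hψ.tangentEquiv.injective) hφ.tangentEquiv.surjective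

/-- The bijection of projective spaces induced by the derivative at `p` of a centred chart. -/
def lineEquiv (hφ : IsCentredChart p φ) :
    ℙ 𝕜 (TangentSpace 𝓘(𝕜, EuclideanSpace 𝕜 (Fin m)) p) ≃ ℙ 𝕜 (EuclideanSpace 𝕜 (Fin m)) :=
  projectivizationEquiv hφ.tangentEquiv.toLinearEquiv

theorem map_fderiv_transition_lineEquiv (hφ : IsCentredChart p φ) (hψ : IsCentredChart p ψ)
    (l : ℙ 𝕜 (TangentSpace 𝓘(𝕜, EuclideanSpace 𝕜 (Fin m)) p)) :
    Projectivization.map (fderiv 𝕜 (ψ ∘ φ.symm) 0).toLinearMap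
      (hφ.injective_fderiv_transition hψ) (hφ.lineEquiv l) = hψ.lineEquiv l := by
  induction l using Projectivization.ind with | h w hw => ?_
  exact congrArg _ (Subtype.ext (hφ.fderiv_transition_tangentEquiv hψ w))

end IsCentredChart

end

/-! ### The blowup of a manifold at a point -/

/-- The blowup of `M` at `p`: the point `p` is replaced by the projective space of the tangent space
at `p`. -/
def Blowup (𝕜 : Type v) [RCLike 𝕜] (m : ℕ) {M : Type u} [TopologicalSpace M]
    [ChartedSpace (EuclideanSpace 𝕜 (Fin m)) M] (p : M) : Type (max u v) :=
  {a : M // a ≠ p} ⊕ ℙ 𝕜 (TangentSpace 𝓘(𝕜, EuclideanSpace 𝕜 (Fin m)) p)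

namespace Blowup

variable {𝕜 : Type v} [RCLike 𝕜] {m : ℕ} {M : Type u} [TopologicalSpace M]
  [ChartedSpace (EuclideanSpace 𝕜 (Fin m)) M] {p : M}
  {φ ψ : OpenPartialHomeomorph M (EuclideanSpace 𝕜 (Fin m))}

/-- The blowdown map from the blowup of `M` at `p` to `M`. -/
def proj (v : Blowup 𝕜 m p) : M := Sum.elim Subtype.val (fun _ => p) v

/-- The point of the blowup over `a`, where `l` only matters if `a = p`. -/
def ofLine (a : M) (l : ℙ 𝕜 (TangentSpace 𝓘(𝕜, EuclideanSpace 𝕜 (Fin m)) p)) : Blowup 𝕜 m p :=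
  open Classical in if ha : a = p then .inr l else .inl ⟨a, ha⟩

@[simp] theorem proj_ofLine (a : M) (l : ℙ 𝕜 (TangentSpace 𝓘(𝕜, EuclideanSpace 𝕜 (Fin m)) p)) :
    (ofLine a l : Blowup 𝕜 m p).proj = a := by
  by_cases ha : a = p <;> simp [ofLine, ha, proj]

theorem eq_of_proj_eq {v w : Blowup 𝕜 m p} (hv : v.proj ≠ p) (h : v.proj = w.proj) : v = w := by
  rcases v with ⟨a, ha⟩ | l
  · rcases w with ⟨b, hb⟩ | l
    · exact congrArg Sum.inl (Subtype.ext h)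
    · exact absurd h hv
  · exact absurd rfl hv

theorem ofLine_self (l : ℙ 𝕜 (TangentSpace 𝓘(𝕜, EuclideanSpace 𝕜 (Fin m)) p)) :
    (ofLine p l : Blowup 𝕜 m p) = .inr l := dif_pos rfl

variable [NeZero m]

instance : Nonempty (ℙ 𝕜 (TangentSpace 𝓘(𝕜, EuclideanSpace 𝕜 (Fin m)) p)) :=
  inferInstanceAs (Nonempty (ℙ 𝕜 (EuclideanSpace 𝕜 (Fin m))))

variable (𝕜 m p) in
/-- The blowdown map identifies the complement of the exceptional locus with `M ∖ {p}`. -/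
def complEquiv : PartialEquiv (Blowup 𝕜 m p) M where
  toFun := proj
  invFun a := ofLine a (Classical.arbitrary _)
  source := {v | v.proj ≠ p}
  target := {p}ᶜ
  map_source' _ hv := hv
  map_target' a ha := by simpa using ha
  left_inv' v hv := eq_of_proj_eq (by simpa using hv) (proj_ofLine _ _)
  right_inv' a _ := proj_ofLine a _

/-- The lift of a centred chart to the blowup: it is determined by the chart away from the
exceptional locus, on which it is given by the derivative of the chart. -/
def liftEquiv (hφ : IsCentredChart p φ) : PartialEquiv (Blowup 𝕜 m p) (BlowupModel 𝕜 m) where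
  toFun := Sum.elim (fun a => .blowdownInv (φ a)) fun l => .zeroSection (hφ.lineEquiv l)
  invFun z := ofLine (φ.symm z.blowdown) (hφ.lineEquiv.symm z.line)
  source := proj ⁻¹' φ.source
  target := BlowupModel.blowdown ⁻¹' φ.target
  map_source' v hv := by
    rcases v with a | l
    · exact φ.map_source hv
    · exact hφ.zero_mem_target
  map_target' z hz := by simpa using φ.map_target hz
  left_inv' v hv := by
    rcases v with a | l
    · exact (eq_of_proj_eq (v := .inl a) a.2
        ((proj_ofLine _ _).trans (φ.left_inv hv)).symm).symm
    · exact (congrArg₂ ofLine hφ.symm_zero (hφ.lineEquiv.symm_apply_apply l)).trans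
        (ofLine_self l)
  right_inv' z hz := by
    by_cases hz0 : z.blowdown = 0
    · simp [hz0, hφ.symm_zero, ofLine_self, BlowupModel.zeroSection_line hz0]
    · simp [ofLine, hφ.symm_apply_ne hz hz0, φ.right_inv hz,
        BlowupModel.blowdownInv_blowdown hz0]

@[simp] theorem complEquiv_target : (complEquiv 𝕜 m p).target = {p}ᶜ := rfl

@[simp] theorem proj_complEquiv_symm (a : M) : ((complEquiv 𝕜 m p).symm a).proj = a :=
  proj_ofLine _ _

theorem proj_surjective : Function.Surjective (proj : Blowup 𝕜 m p → M) :=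
  fun a => ⟨_, proj_complEquiv_symm a⟩

@[simp] theorem liftEquiv_source (hφ : IsCentredChart p φ) :
    (liftEquiv hφ).source = proj ⁻¹' φ.source := rfl

@[simp] theorem liftEquiv_target (hφ : IsCentredChart p φ) :
    (liftEquiv hφ).target = BlowupModel.blowdown ⁻¹' φ.target := rfl

theorem liftEquiv_complEquiv_symm (hφ : IsCentredChart p φ) {a : M} (ha : a ≠ p) :
    liftEquiv hφ ((complEquiv 𝕜 m p).symm a) = .blowdownInv (φ a) :=
  congrArg (liftEquiv hφ) (dif_neg ha)

theorem blowdown_liftEquiv (hφ : IsCentredChart p φ) (v : Blowup 𝕜 m p) :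
    (liftEquiv hφ v).blowdown = φ v.proj := by
  rcases v with a | _
  · rfl
  · exact hφ.map_eq_zero.symm

@[simp] theorem proj_liftEquiv_symm (hφ : IsCentredChart p φ) (z : BlowupModel 𝕜 m) :
    ((liftEquiv hφ).symm z).proj = φ.symm z.blowdown := proj_ofLine _ _

theorem liftEquiv_liftEquiv_symm (hφ : IsCentredChart p φ) (hψ : IsCentredChart p ψ)
    {z : BlowupModel 𝕜 m} (hz : z.blowdown ∈ (φ.symm.trans ψ).source) :
    liftEquiv hψ ((liftEquiv hφ).symm z) = BlowupModel.lift (ψ ∘ φ.symm) z := by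
  by_cases hz0 : z.blowdown = 0
  · obtain ⟨l, rfl⟩ : ∃ l, .zeroSection (hφ.lineEquiv l) = z :=
      ⟨hφ.lineEquiv.symm z.line, by
        rw [Equiv.apply_symm_apply, BlowupModel.zeroSection_line hz0]⟩
    rw [BlowupModel.lift_zeroSection (hφ.injective_fderiv_transition hψ),
      hφ.map_fderiv_transition_lineEquiv hψ]
    exact congrArg (liftEquiv hψ) ((liftEquiv hφ).left_inv (x := .inr l) hφ.mem_source)
  · have hb : (liftEquiv hψ ((liftEquiv hφ).symm z)).blowdown = ψ (φ.symm z.blowdown) := by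
      rw [blowdown_liftEquiv, proj_liftEquiv_symm]
    refine BlowupModel.eq_of_blowdown_eq (hb ▸ hψ.apply_ne_zero hz.2 ?_)
      (hb.trans (BlowupModel.blowdown_lift (hφ.transition_zero hψ) z).symm)
    exact hφ.symm_apply_ne hz.1 hz0

/-! ### Coordinate changes of the blowup -/

theorem isSmoothOnSource_complEquiv_complEquiv [T1Space M] :
    IsSmoothOnSource 𝓘(𝕜, EuclideanSpace 𝕜 (Fin m)) ∞
      ((complEquiv 𝕜 m p).symm.trans (complEquiv 𝕜 m p)) where
  isOpen_source := by
    rw [(PartialEquiv.symm_trans_self _).source_eq]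
    exact isOpen_compl_singleton
  contMDiffOn := contMDiffOn_id.congr fun a _ => proj_ofLine a _

theorem source_complEquiv_liftEquiv (hφ : IsCentredChart p φ) :
    ((complEquiv 𝕜 m p).symm.trans (liftEquiv hφ)).source = {p}ᶜ ∩ φ.source := by
  ext a
  simp

theorem isSmoothOnSource_complEquiv_liftEquiv [T1Space M] (hφ : IsCentredChart p φ) :
    IsSmoothOnSource 𝓘(𝕜, EuclideanSpace 𝕜 (Fin m)) ∞
      ((complEquiv 𝕜 m p).symm.trans (liftEquiv hφ)) where
  isOpen_source := by
    rw [source_complEquiv_liftEquiv]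
    exact isOpen_compl_singleton.inter φ.open_source
  contMDiffOn := by
    rw [source_complEquiv_liftEquiv]
    refine ContMDiffOn.congr (f := fun a => BlowupModel.blowdownInv (φ a)) (fun a ha => ?_)
      fun a ha => liftEquiv_complEquiv_symm hφ ha.1
    have hφa := (contMDiffOn_of_mem_maximalAtlas hφ.mem_maximalAtlas).mono inter_subset_right a ha
    exact (BlowupModel.contMDiffAt_blowdownInv
      (hφ.apply_ne_zero ha.2 ha.1)).comp_contMDiffWithinAt a hφa

theorem source_liftEquiv_complEquiv (hφ : IsCentredChart p φ) :
    ((liftEquiv hφ).symm.trans (complEquiv 𝕜 m p)).source =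
      BlowupModel.blowdown ⁻¹' (φ.target ∩ {0}ᶜ) := by
  ext z
  change z.blowdown ∈ φ.target ∧ ((liftEquiv hφ).symm z).proj ≠ p ↔ _
  rw [proj_liftEquiv_symm]
  refine and_congr_right fun hz => not_congr ⟨fun h => ?_, fun h : z.blowdown = 0 => ?_⟩
  · exact (φ.right_inv hz).symm.trans ((congrArg φ h).trans hφ.map_eq_zero)
  · rw [h, hφ.symm_zero]

theorem isSmoothOnSource_liftEquiv_complEquiv (hφ : IsCentredChart p φ) :
    IsSmoothOnSource 𝓘(𝕜, EuclideanSpace 𝕜 (Fin m)) ∞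
      ((liftEquiv hφ).symm.trans (complEquiv 𝕜 m p)) where
  isOpen_source := by
    rw [source_liftEquiv_complEquiv]
    exact (φ.open_target.inter isOpen_compl_singleton).preimage BlowupModel.continuous_blowdown
  contMDiffOn := by
    rw [source_liftEquiv_complEquiv]
    exact ((contMDiffOn_symm_of_mem_maximalAtlas hφ.mem_maximalAtlas).comp
      BlowupModel.contMDiff_blowdown.contMDiffOn fun z hz => hz.1).congr
      fun z _ => proj_liftEquiv_symm hφ z

theorem source_liftEquiv_liftEquiv (hφ : IsCentredChart p φ) (hψ : IsCentredChart p ψ) :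
    ((liftEquiv hφ).symm.trans (liftEquiv hψ)).source =
      BlowupModel.blowdown ⁻¹' (φ.symm.trans ψ).source := by
  ext z
  simp

theorem isSmoothOnSource_liftEquiv_liftEquiv (hφ : IsCentredChart p φ)
    (hψ : IsCentredChart p ψ) :
    IsSmoothOnSource 𝓘(𝕜, EuclideanSpace 𝕜 (Fin m)) ∞
      ((liftEquiv hφ).symm.trans (liftEquiv hψ)) where
  isOpen_source := by
    rw [source_liftEquiv_liftEquiv]
    exact (φ.symm.trans ψ).open_source.preimage BlowupModel.continuous_blowdown
  contMDiffOn := by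
    rw [source_liftEquiv_liftEquiv]
    refine (BlowupModel.contMDiffOn_lift (φ.symm.trans ψ).open_source
      (hφ.contDiffOn_transition hψ) (hφ.transition_zero hψ) (hφ.injective_fderiv_transition hψ)
      fun x hx h0 => ?_).congr fun z hz => liftEquiv_liftEquiv_symm hφ hψ hz
    by_contra hx0
    exact hψ.apply_ne_zero hx.2 (hφ.symm_apply_ne hx.1 hx0) h0

end Blowup

/-! ### The manifold structure of the blowup -/

namespace Blowup

section

variable {𝕜 : Type v} [RCLike 𝕜] {m : ℕ} [NeZero m] {M : Type u} [TopologicalSpace M]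
  [ChartedSpace (EuclideanSpace 𝕜 (Fin m)) M] {p : M}
  {φ : OpenPartialHomeomorph M (EuclideanSpace 𝕜 (Fin m))}
  {N : Type*} [TopologicalSpace N] [ChartedSpace (EuclideanSpace 𝕜 (Fin m)) N]

/-- The coordinate changes between `e` and the partial equivalences `complEquiv` and `liftEquiv`
are smooth: these are the `e` which become isomorphisms for the manifold structure of the blowup. -/
structure IsCompatible (e : PartialEquiv (Blowup 𝕜 m p) N) : Prop where
  complEquiv_symm_trans : IsSmoothOnSource 𝓘(𝕜, EuclideanSpace 𝕜 (Fin m)) ∞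
    ((complEquiv 𝕜 m p).symm.trans e)
  symm_trans_complEquiv : IsSmoothOnSource 𝓘(𝕜, EuclideanSpace 𝕜 (Fin m)) ∞
    (e.symm.trans (complEquiv 𝕜 m p))
  liftEquiv_symm_trans : ∀ {φ : OpenPartialHomeomorph M (EuclideanSpace 𝕜 (Fin m))}
    (hφ : IsCentredChart p φ), IsSmoothOnSource 𝓘(𝕜, EuclideanSpace 𝕜 (Fin m)) ∞
      ((liftEquiv hφ).symm.trans e)
  symm_trans_liftEquiv : ∀ {φ : OpenPartialHomeomorph M (EuclideanSpace 𝕜 (Fin m))}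
    (hφ : IsCentredChart p φ), IsSmoothOnSource 𝓘(𝕜, EuclideanSpace 𝕜 (Fin m)) ∞
      (e.symm.trans (liftEquiv hφ))

theorem isCompatible_complEquiv [T1Space M] : IsCompatible (complEquiv 𝕜 m p) where
  complEquiv_symm_trans := isSmoothOnSource_complEquiv_complEquiv
  symm_trans_complEquiv := isSmoothOnSource_complEquiv_complEquiv
  liftEquiv_symm_trans := isSmoothOnSource_liftEquiv_complEquiv
  symm_trans_liftEquiv := isSmoothOnSource_complEquiv_liftEquiv

theorem isCompatible_liftEquiv [T1Space M] (hφ : IsCentredChart p φ) :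
    IsCompatible (liftEquiv hφ) where
  complEquiv_symm_trans := isSmoothOnSource_complEquiv_liftEquiv hφ
  symm_trans_complEquiv := isSmoothOnSource_liftEquiv_complEquiv hφ
  liftEquiv_symm_trans hψ := isSmoothOnSource_liftEquiv_liftEquiv hψ hφ
  symm_trans_liftEquiv := isSmoothOnSource_liftEquiv_liftEquiv hφ

variable (𝕜 m p) in
/-- The charts of the blowup, without their continuity: those of `M` away from the exceptional
locus, and those of the model blowup transported by the lifts of centred charts. -/
def coreAtlas : Set (PartialEquiv (Blowup 𝕜 m p) (EuclideanSpace 𝕜 (Fin m))) :=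
  {f | (∃ c ∈ IsManifold.maximalAtlas 𝓘(𝕜, EuclideanSpace 𝕜 (Fin m)) ∞ M,
      f = (complEquiv 𝕜 m p).trans c.toPartialEquiv) ∨
    ∃ (φ : OpenPartialHomeomorph M (EuclideanSpace 𝕜 (Fin m))) (hφ : IsCentredChart p φ),
      ∃ c ∈ IsManifold.maximalAtlas 𝓘(𝕜, EuclideanSpace 𝕜 (Fin m)) ∞ (BlowupModel 𝕜 m),
        f = (liftEquiv hφ).trans c.toPartialEquiv}

theorem IsCompatible.symm_trans_coreAtlas {e : PartialEquiv (Blowup 𝕜 m p) N}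
    (he : IsCompatible e) {f : PartialEquiv (Blowup 𝕜 m p) (EuclideanSpace 𝕜 (Fin m))}
    (hf : f ∈ coreAtlas 𝕜 m p) :
    IsSmoothOnSource 𝓘(𝕜, EuclideanSpace 𝕜 (Fin m)) ∞ (e.symm.trans f) := by
  obtain ⟨c, hc, rfl⟩ | ⟨φ, hφ, c, hc, rfl⟩ := hf
  all_goals rw [← PartialEquiv.trans_assoc]
  · exact he.symm_trans_complEquiv.trans (.of_mem_maximalAtlas hc)
  · exact (he.symm_trans_liftEquiv hφ).trans (.of_mem_maximalAtlas hc)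

theorem IsCompatible.coreAtlas_symm_trans {e : PartialEquiv (Blowup 𝕜 m p) N}
    (he : IsCompatible e) {f : PartialEquiv (Blowup 𝕜 m p) (EuclideanSpace 𝕜 (Fin m))}
    (hf : f ∈ coreAtlas 𝕜 m p) :
    IsSmoothOnSource 𝓘(𝕜, EuclideanSpace 𝕜 (Fin m)) ∞ (f.symm.trans e) := by
  obtain ⟨c, hc, rfl⟩ | ⟨φ, hφ, c, hc, rfl⟩ := hf
  all_goals rw [PartialEquiv.trans_symm_eq_symm_trans_symm, PartialEquiv.trans_assoc]
  · exact (IsSmoothOnSource.symm_of_mem_maximalAtlas hc).trans he.complEquiv_symm_trans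
  · exact (IsSmoothOnSource.symm_of_mem_maximalAtlas hc).trans (he.liftEquiv_symm_trans hφ)

theorem isSmoothOnSource_of_mem_coreAtlas [T1Space M]
    {f f' : PartialEquiv (Blowup 𝕜 m p) (EuclideanSpace 𝕜 (Fin m))}
    (hf : f ∈ coreAtlas 𝕜 m p) (hf' : f' ∈ coreAtlas 𝕜 m p) :
    IsSmoothOnSource 𝓘(𝕜, EuclideanSpace 𝕜 (Fin m)) ∞ (f.symm.trans f') := by
  obtain ⟨c, hc, rfl⟩ | ⟨φ, hφ, c, hc, rfl⟩ := hf
  all_goals rw [PartialEquiv.trans_symm_eq_symm_trans_symm, PartialEquiv.trans_assoc]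
  · exact (IsSmoothOnSource.symm_of_mem_maximalAtlas hc).trans
      (isCompatible_complEquiv.symm_trans_coreAtlas hf')
  · exact (IsSmoothOnSource.symm_of_mem_maximalAtlas hc).trans
      ((isCompatible_liftEquiv hφ).symm_trans_coreAtlas hf')

variable [IsManifold 𝓘(𝕜, EuclideanSpace 𝕜 (Fin m)) ∞ M]

theorem exists_mem_coreAtlas (v : Blowup 𝕜 m p) : ∃ f ∈ coreAtlas 𝕜 m p, v ∈ f.source := by
  by_cases hv : v.proj = p
  · obtain ⟨φ, hφ⟩ := exists_isCentredChart 𝕜 m p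
    refine ⟨_, .inr ⟨φ, hφ, _, IsManifold.chart_mem_maximalAtlas (liftEquiv hφ v), rfl⟩, ?_⟩
    simpa [hv] using hφ.mem_source
  · exact ⟨_, .inl ⟨_, IsManifold.chart_mem_maximalAtlas v.proj, rfl⟩, hv,
      mem_chart_source _ v.proj⟩

variable [T1Space M]

variable (𝕜 m p) in
/-- The atlas which defines both the topology and the manifold structure of the blowup. -/
def chartedSpaceCore : ChartedSpaceCore (EuclideanSpace 𝕜 (Fin m)) (Blowup 𝕜 m p) where
  atlas := coreAtlas 𝕜 m p
  chartAt v := (exists_mem_coreAtlas v).choose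
  mem_chart_source v := (exists_mem_coreAtlas v).choose_spec.2
  chart_mem_atlas v := (exists_mem_coreAtlas v).choose_spec.1
  open_source _ _ hf hf' := (isSmoothOnSource_of_mem_coreAtlas hf hf').isOpen_source
  continuousOn_toFun _ _ hf hf' :=
    (isSmoothOnSource_of_mem_coreAtlas hf hf').contMDiffOn.continuousOn

instance : TopologicalSpace (Blowup 𝕜 m p) := (chartedSpaceCore 𝕜 m p).toTopologicalSpace

instance : ChartedSpace (EuclideanSpace 𝕜 (Fin m)) (Blowup 𝕜 m p) :=
  (chartedSpaceCore 𝕜 m p).toChartedSpace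

theorem toPartialEquiv_mem_coreAtlas
    {c : OpenPartialHomeomorph (Blowup 𝕜 m p) (EuclideanSpace 𝕜 (Fin m))}
    (hc : c ∈ atlas (EuclideanSpace 𝕜 (Fin m)) (Blowup 𝕜 m p)) :
    c.toPartialEquiv ∈ coreAtlas 𝕜 m p := by
  obtain ⟨f, hf, hcf⟩ := mem_iUnion₂.1 hc
  obtain rfl := mem_singleton_iff.1 hcf
  exact hf

instance : IsManifold 𝓘(𝕜, EuclideanSpace 𝕜 (Fin m)) ∞ (Blowup 𝕜 m p) := by
  refine isManifold_of_contDiffOn _ _ _ fun c c' hc hc' => ?_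
  simpa using contMDiffOn_iff_contDiffOn.1 (isSmoothOnSource_of_mem_coreAtlas
    (toPartialEquiv_mem_coreAtlas hc) (toPartialEquiv_mem_coreAtlas hc')).contMDiffOn

theorem IsCompatible.isSmoothOnSource {e : PartialEquiv (Blowup 𝕜 m p) N} (he : IsCompatible e) :
    IsSmoothOnSource 𝓘(𝕜, EuclideanSpace 𝕜 (Fin m)) ∞ e :=
  .of_chartAt_symm_trans fun v =>
    he.coreAtlas_symm_trans (toPartialEquiv_mem_coreAtlas (chart_mem_atlas _ v))

theorem IsCompatible.isSmoothOnSource_symm {e : PartialEquiv (Blowup 𝕜 m p) N}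
    (he : IsCompatible e) : IsSmoothOnSource 𝓘(𝕜, EuclideanSpace 𝕜 (Fin m)) ∞ e.symm :=
  .of_trans_chartAt fun v =>
    he.symm_trans_coreAtlas (toPartialEquiv_mem_coreAtlas (chart_mem_atlas _ v))

variable (𝕜 m p) in
/-- `complEquiv` as an open partial homeomorphism. -/
def complChart : OpenPartialHomeomorph (Blowup 𝕜 m p) M :=
  isCompatible_complEquiv.isSmoothOnSource.toOpenPartialHomeomorph
    isCompatible_complEquiv.isSmoothOnSource_symm

/-- `liftEquiv` as an open partial homeomorphism. -/
def liftChart (hφ : IsCentredChart p φ) :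
    OpenPartialHomeomorph (Blowup 𝕜 m p) (BlowupModel 𝕜 m) :=
  (isCompatible_liftEquiv hφ).isSmoothOnSource.toOpenPartialHomeomorph
    (isCompatible_liftEquiv hφ).isSmoothOnSource_symm

end

end Blowup

/-! ### Topology of the blowup -/

namespace Blowup

section

variable {𝕜 : Type v} [RCLike 𝕜] {m : ℕ} [NeZero m] {M : Type u} [TopologicalSpace M]
  [ChartedSpace (EuclideanSpace 𝕜 (Fin m)) M] [IsManifold 𝓘(𝕜, EuclideanSpace 𝕜 (Fin m)) ∞ M]
  {p : M} {φ ψ : OpenPartialHomeomorph M (EuclideanSpace 𝕜 (Fin m))}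

section

variable [T1Space M]

theorem isChartLift_liftChart (hφ : IsCentredChart p φ) : IsChartLift proj φ (liftChart hφ) where
  source_eq := liftEquiv_source hφ
  target_eq := liftEquiv_target hφ
  contMDiffOn_toFun := (isCompatible_liftEquiv hφ).isSmoothOnSource.contMDiffOn
  contMDiffOn_symm := (isCompatible_liftEquiv hφ).isSmoothOnSource_symm.contMDiffOn
  blowdown_comp v _ := blowdown_liftEquiv hφ v

theorem mem_liftChart_source (hφ : IsCentredChart p φ) {v : Blowup 𝕜 m p} (hv : v.proj = p) :
    v ∈ (liftChart hφ).source :=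
  show v.proj ∈ φ.source from hv.symm ▸ hφ.mem_source

theorem mem_liftChart_target (hφ : IsCentredChart p φ) {z : BlowupModel 𝕜 m}
    (hz : z.blowdown = 0) : z ∈ (liftChart hφ).target :=
  show z.blowdown ∈ φ.target from hz ▸ hφ.zero_mem_target

theorem contMDiff_proj : ContMDiff 𝓘(𝕜, EuclideanSpace 𝕜 (Fin m))
    𝓘(𝕜, EuclideanSpace 𝕜 (Fin m)) ∞ (proj : Blowup 𝕜 m p → M) := by
  intro v
  by_cases hv : v.proj = p
  · obtain ⟨φ, hφ⟩ := exists_isCentredChart 𝕜 m p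
    have hΦ := isChartLift_liftChart hφ
    have hvs := mem_liftChart_source hφ hv
    have hφs := contMDiffAt_symm_of_mem_maximalAtlas hφ.mem_maximalAtlas
      ((liftChart hφ).map_source hvs)
    refine ContMDiffAt.congr_of_eventuallyEq (hφs.comp v (BlowupModel.contMDiff_blowdown.contMDiffAt
      |>.comp v (hΦ.contMDiffOn_toFun.contMDiffAt ((liftChart hφ).open_source.mem_nhds hvs)))) ?_
    filter_upwards [(liftChart hφ).open_source.mem_nhds hvs] with w hw
    exact ((congrArg φ.symm (hΦ.blowdown_comp w hw)).trans (φ.left_inv hw)).symm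
  · exact isCompatible_complEquiv.isSmoothOnSource.contMDiffOn.contMDiffAt
      ((complChart 𝕜 m p).open_source.mem_nhds hv)

theorem continuous_proj : Continuous (proj : Blowup 𝕜 m p → M) := contMDiff_proj.continuous

instance [SecondCountableTopology M] : SecondCountableTopology (Blowup 𝕜 m p) := by
  obtain ⟨φ, hφ⟩ := exists_isCentredChart 𝕜 m p
  let U : Bool → Set (Blowup 𝕜 m p) :=
    fun b => cond b (complChart 𝕜 m p).source (liftChart hφ).source
  have hU (b : Bool) : IsOpen (U b) := by
    cases b
    exacts [(liftChart hφ).open_source, (complChart 𝕜 m p).open_source]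
  have (b : Bool) : SecondCountableTopology (U b) := by
    cases b
    exacts [(liftChart hφ).secondCountableTopology_source,
      (complChart 𝕜 m p).secondCountableTopology_source]
  refine TopologicalSpace.secondCountableTopology_of_countable_cover hU
    (eq_univ_of_forall fun v => mem_iUnion.2 ?_)
  by_cases hv : v.proj = p
  exacts [⟨false, mem_liftChart_source hφ hv⟩, ⟨true, hv⟩]

theorem eventually_forall_mem_of_isOpen {W : Set (Blowup 𝕜 m p)} (hW : IsOpen W)
    (hpW : proj ⁻¹' {p} ⊆ W) : ∀ᶠ a in 𝓝 p, ∀ v : Blowup 𝕜 m p, v.proj = a → v ∈ W := by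
  obtain ⟨φ, hφ⟩ := exists_isCentredChart 𝕜 m p
  have hmodel : ∀ᶠ x in 𝓝 (φ p), ∀ z : BlowupModel 𝕜 m, z.blowdown = x →
      z ∈ (liftChart hφ).target ∩ (liftChart hφ).symm ⁻¹' W := by
    rw [hφ.map_eq_zero]
    refine BlowupModel.eventually_forall_mem_of_isOpen
      ((liftChart hφ).isOpen_inter_preimage_symm hW) fun z hz => ⟨mem_liftChart_target hφ hz, ?_⟩
    refine hpW ((proj_liftEquiv_symm hφ z).trans ?_)
    rw [hz, hφ.symm_zero]
  filter_upwards [(φ.continuousAt hφ.mem_source).eventually hmodel,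
    φ.open_source.mem_nhds hφ.mem_source] with a ha haφ v hv
  have hvφ : v ∈ (liftChart hφ).source := show v.proj ∈ φ.source from hv ▸ haφ
  rw [← (liftChart hφ).left_inv hvφ]
  exact (ha _ (hv ▸ blowdown_liftEquiv hφ v)).2

theorem isQuotientMap_proj : IsQuotientMap (proj : Blowup 𝕜 m p → M) := by
  refine (isQuotientMap_iff _).2 ⟨.of_isOpen_preimage_iff_isOpen fun O =>
    ⟨fun hO => isOpen_iff_mem_nhds.2 fun a ha => ?_, fun hO => hO.preimage continuous_proj⟩,
    proj_surjective⟩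
  obtain rfl | hap := eq_or_ne a p
  · filter_upwards [eventually_forall_mem_of_isOpen hO fun v (hv : v.proj = a) =>
      show v.proj ∈ O from hv.symm ▸ ha] with b hb
    obtain ⟨v, rfl⟩ := proj_surjective (𝕜 := 𝕜) (m := m) (p := a) b
    exact hb v rfl
  · refine Filter.mem_of_superset
      (((complChart 𝕜 m p).isOpen_image_source_inter hO).mem_nhds ?_)
      (image_subset_iff.2 inter_subset_right)
    exact ⟨(complEquiv 𝕜 m p).symm a, ⟨(complEquiv 𝕜 m p).map_target hap, by simpa using ha⟩,
      proj_complEquiv_symm a⟩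

/-! ### The exceptional locus -/

/-- The parametrization of the exceptional locus given by the lift of a centred chart. -/
def exceptionalMap (hφ : IsCentredChart p φ) (l : ℙ 𝕜 (EuclideanSpace 𝕜 (Fin m))) :
    Blowup 𝕜 m p :=
  (liftChart hφ).symm (BlowupModel.zeroSection l)

theorem liftChart_exceptionalMap (hφ : IsCentredChart p φ)
    (l : ℙ 𝕜 (EuclideanSpace 𝕜 (Fin m))) :
    liftChart hφ (exceptionalMap hφ l) = BlowupModel.zeroSection l :=
  (liftChart hφ).right_inv (mem_liftChart_target hφ (BlowupModel.blowdown_zeroSection l))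

theorem injective_exceptionalMap (hφ : IsCentredChart p φ) :
    Function.Injective (exceptionalMap hφ) := fun l l' h => by
  simpa [liftChart_exceptionalMap] using congrArg (fun v => (liftChart hφ v).line) h

theorem continuous_exceptionalMap (hφ : IsCentredChart p φ) : Continuous (exceptionalMap hφ) :=
  (liftChart hφ).continuousOn_symm.comp_continuous BlowupModel.continuous_zeroSection
    fun l => mem_liftChart_target hφ (BlowupModel.blowdown_zeroSection l)

theorem range_exceptionalMap (hφ : IsCentredChart p φ) :
    range (exceptionalMap hφ) = proj ⁻¹' {p} := by
  refine Subset.antisymm (range_subset_iff.2 fun l => ?_) fun v hv => ⟨(liftChart hφ v).line, ?_⟩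
  · exact (proj_liftEquiv_symm hφ _).trans hφ.symm_zero
  · have hv0 : (liftChart hφ v).blowdown = 0 :=
      (blowdown_liftEquiv hφ v).trans (by rw [show v.proj = p from hv, hφ.map_eq_zero])
    rw [exceptionalMap, BlowupModel.zeroSection_line hv0,
      (liftChart hφ).left_inv (mem_liftChart_source hφ hv)]

theorem isConnected_preimage_proj : IsConnected (proj ⁻¹' {p} : Set (Blowup 𝕜 m p)) := by
  obtain ⟨φ, hφ⟩ := exists_isCentredChart 𝕜 m p
  exact range_exceptionalMap hφ ▸ isConnected_range (continuous_exceptionalMap hφ)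

theorem isCompact_preimage_proj : IsCompact (proj ⁻¹' {p} : Set (Blowup 𝕜 m p)) := by
  obtain ⟨φ, hφ⟩ := exists_isCentredChart 𝕜 m p
  exact range_exceptionalMap hφ ▸ isCompact_range (continuous_exceptionalMap hφ)

variable (𝕜 m p) in
/-- The blowdown map as an isomorphism of the complement of the exceptional locus with
`M ∖ {p}`. -/
def complDiffeomorph :
    Diffeomorph 𝓘(𝕜, EuclideanSpace 𝕜 (Fin m)) 𝓘(𝕜, EuclideanSpace 𝕜 (Fin m))
      (Opens.comap ⟨proj, continuous_proj⟩ ⟨{p}ᶜ, isOpen_compl_singleton⟩ :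
        Opens (Blowup 𝕜 m p))
      (⟨{p}ᶜ, isOpen_compl_singleton⟩ : Opens M) ∞ where
  toFun v := ⟨proj v.1, v.2⟩
  invFun a := ⟨(complEquiv 𝕜 m p).symm a, (complEquiv 𝕜 m p).map_target a.2⟩
  left_inv v := Subtype.ext ((complEquiv 𝕜 m p).left_inv v.2)
  right_inv a := Subtype.ext (proj_complEquiv_symm a.1)
  contMDiff_toFun := by
    rw [← ContMDiff.subtypeVal_comp_iff]
    exact contMDiff_proj.comp contMDiff_subtype_val
  contMDiff_invFun := by
    rw [← ContMDiff.subtypeVal_comp_iff]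
    exact isCompatible_complEquiv.isSmoothOnSource_symm.contMDiffOn.comp_contMDiff
      contMDiff_subtype_val Subtype.property

theorem isTopologicalBlowup_proj : IsTopologicalBlowup (proj : Blowup 𝕜 m p → M) p where
  isQuotientMap := isQuotientMap_proj
  isConnected := isConnected_preimage_proj
  isCompact := isCompact_preimage_proj
  isHomeomorph := (complDiffeomorph 𝕜 m p).toHomeomorph.isHomeomorph

theorem exists_forall_isChartLift :
    ∃ L : OpenPartialHomeomorph M (EuclideanSpace 𝕜 (Fin m)) →
        OpenPartialHomeomorph (Blowup 𝕜 m p) (BlowupModel 𝕜 m),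
      (∀ φ, IsCentredChart p φ → IsChartLift proj φ (L φ)) ∧
      ∀ φ ψ, IsCentredChart p φ → IsCentredChart p ψ → ∀ z ∈ (L φ).target,
        φ.symm z.blowdown ∈ ψ.source → L ψ ((L φ).symm z) = BlowupModel.lift (ψ ∘ φ.symm) z := by
  classical
  obtain ⟨φ₀, hφ₀⟩ := exists_isCentredChart 𝕜 m p
  refine ⟨fun φ => if hφ : IsCentredChart p φ then liftChart hφ else liftChart hφ₀,
    fun φ hφ => ?_, fun φ ψ hφ hψ z hz hzψ => ?_⟩
  · simpa only [dif_pos hφ] using isChartLift_liftChart hφ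
  · simp only [dif_pos hφ, dif_pos hψ] at hz ⊢
    exact liftEquiv_liftEquiv_symm hφ hψ ⟨hz, hzψ⟩

end

instance [T2Space M] : T2Space (Blowup 𝕜 m p) := by
  refine ⟨fun v w hvw => ?_⟩
  by_cases h : v.proj = w.proj
  · obtain ⟨φ, hφ⟩ := exists_isCentredChart 𝕜 m p
    have hvp : v.proj = p := by_contra fun hvp => hvw (eq_of_proj_eq hvp h)
    have hv := mem_liftChart_source hφ hvp
    have hw := mem_liftChart_source hφ (h ▸ hvp)
    obtain ⟨A, B, hA, hB, hvA, hwB, hAB⟩ := t2_separation ((liftChart hφ).injOn.ne hv hw hvw)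
    exact ⟨_, _, (liftChart hφ).isOpen_inter_preimage hA, (liftChart hφ).isOpen_inter_preimage hB,
      ⟨hv, hvA⟩, ⟨hw, hwB⟩, (hAB.preimage _).mono inter_subset_right inter_subset_right⟩
  · exact separated_by_continuous continuous_proj h

end

end Blowup

/-! ### The exceptional locus as a submanifold -/

/-- The linear isomorphism inserting a scalar as the `j`-th coordinate. -/
def insertNthEquivL (𝕜 : Type*) [RCLike 𝕜] {n : ℕ} (j : Fin (n + 1)) :
    (EuclideanSpace 𝕜 (Fin n) × 𝕜) ≃L[𝕜] EuclideanSpace 𝕜 (Fin (n + 1)) :=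
  LinearEquiv.toContinuousLinearEquiv
    { toFun := fun w => WithLp.toLp 2 (j.insertNth w.2 (fun i => w.1 i) : Fin (n + 1) → 𝕜)
      invFun := fun x => (WithLp.toLp 2 fun i => x (j.succAbove i), x j)
      map_add' := fun w w' => by
        ext i
        cases i using j.succAboveCases <;> simp
      map_smul' := fun a w => by
        ext i
        cases i using j.succAboveCases <;> simp
      left_inv := fun w => by simp
      right_inv := fun x => by
        ext i
        cases i using j.succAboveCases <;> simp }

theorem BlowupModel.chart_zeroSection_affineChart_symm {𝕜 : Type*} [RCLike 𝕜] {n : ℕ}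
    (j : Fin (n + 1)) (w : EuclideanSpace 𝕜 (Fin n)) :
    chart 𝕜 (n + 1) j (zeroSection ((Projectivization.affineChart 𝕜 n j).symm w)) =
      insertNthEquivL 𝕜 j (w, 0) := by
  ext i
  change (if i = j then (0 : 𝕜) else
    (Projectivization.mk 𝕜 _ (Projectivization.insertOne_ne_zero j w)).rep i /
      (Projectivization.mk 𝕜 _ (Projectivization.insertOne_ne_zero j w)).rep j) =
    (j.insertNth (0 : 𝕜) (fun i => w i) : Fin (n + 1) → 𝕜) i
  rw [Projectivization.rep_mk_div]
  cases i using j.succAboveCases <;> simp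

theorem Blowup.isSmoothEmbedding_exceptionalMap {𝕜 : Type v} [RCLike 𝕜] {n : ℕ} {M : Type u}
    [TopologicalSpace M] [T2Space M] [ChartedSpace (EuclideanSpace 𝕜 (Fin (n + 1))) M]
    [IsManifold 𝓘(𝕜, EuclideanSpace 𝕜 (Fin (n + 1))) ∞ M] {p : M}
    {φ : OpenPartialHomeomorph M (EuclideanSpace 𝕜 (Fin (n + 1)))} (hφ : IsCentredChart p φ) :
    IsSmoothEmbedding 𝓘(𝕜, EuclideanSpace 𝕜 (Fin n)) 𝓘(𝕜, EuclideanSpace 𝕜 (Fin (n + 1))) ∞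
      (exceptionalMap hφ) := by
  refine ⟨IsImmersionOfComplement.isImmersion (F := 𝕜) fun l => ?_,
    ((continuous_exceptionalMap hφ).isClosedEmbedding (injective_exceptionalMap hφ)).isEmbedding⟩
  obtain ⟨j, hj⟩ := Projectivization.exists_rep_ne_zero l
  have hΦ := isChartLift_liftChart hφ
  have hc := BlowupModel.chart_mem_maximalAtlas (𝕜 := 𝕜) j
  have hmem : (liftChart hφ ≫ₕ BlowupModel.chart 𝕜 (n + 1) j) ∈
      IsManifold.maximalAtlas 𝓘(𝕜, EuclideanSpace 𝕜 (Fin (n + 1))) ∞ (Blowup 𝕜 (n + 1) p) :=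
    OpenPartialHomeomorph.mem_maximalAtlas_of_contMDiffOn _
      ((contMDiffOn_of_mem_maximalAtlas hc).comp
        (hΦ.contMDiffOn_toFun.mono inter_subset_left) inter_subset_right)
      (hΦ.contMDiffOn_symm.comp
        ((contMDiffOn_symm_of_mem_maximalAtlas hc).mono inter_subset_left) inter_subset_right)
  refine IsImmersionAtOfComplement.mk_of_continuousAt
    (continuous_exceptionalMap hφ).continuousAt (insertNthEquivL 𝕜 j)
    (Projectivization.affineChart 𝕜 n j) _ hj ?_
    (IsManifold.subset_maximalAtlas (mem_range_self j)) hmem fun w _ => ?_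
  · rw [OpenPartialHomeomorph.trans_source, mem_inter_iff, mem_preimage, liftChart_exceptionalMap]
    exact ⟨(liftChart hφ).map_target (mem_liftChart_target hφ (z := .zeroSection l) rfl), hj⟩
  · change BlowupModel.chart 𝕜 (n + 1) j (liftChart hφ (exceptionalMap hφ _)) = _
    rw [liftChart_exceptionalMap]
    exact BlowupModel.chart_zeroSection_affineChart_symm j w

end

theorem mainTheorem5 {𝕜 : Type v} [RCLike 𝕜] (n : ℕ) {M : Type u}
    [TopologicalSpace M] [T2Space M] [ChartedSpace (EuclideanSpace 𝕜 (Fin (n + 1))) M]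
    [IsManifold 𝓘(𝕜, EuclideanSpace 𝕜 (Fin (n + 1))) ∞ M] (p : M) :
    ∃ (V : Type (max u v)) (_ : TopologicalSpace V)
      (_ : ChartedSpace (EuclideanSpace 𝕜 (Fin (n + 1))) V) (q : C(V, M)),
      -- `V` is a smooth (complex) manifold
      T2Space V ∧ (SecondCountableTopology M → SecondCountableTopology V) ∧
      IsManifold 𝓘(𝕜, EuclideanSpace 𝕜 (Fin (n + 1))) ∞ V ∧
      -- `q` is a smooth (holomorphic) map and a topological blowup of `M` at `p`
      ContMDiff 𝓘(𝕜, EuclideanSpace 𝕜 (Fin (n + 1))) 𝓘(𝕜, EuclideanSpace 𝕜 (Fin (n + 1))) ∞ q ∧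
      IsTopologicalBlowup q p ∧
      -- `q` restricts to an isomorphism `V ∖ Σ ≅ M ∖ {p}`
      (∃ Θ : Diffeomorph 𝓘(𝕜, EuclideanSpace 𝕜 (Fin (n + 1)))
          𝓘(𝕜, EuclideanSpace 𝕜 (Fin (n + 1)))
          (Opens.comap q ⟨{p}ᶜ, isOpen_compl_singleton⟩ : Opens V)
          (⟨{p}ᶜ, isOpen_compl_singleton⟩ : Opens M) ∞,
        ∀ x, ((Θ x : M) = q x)) ∧
      -- `Σ = q ⁻¹' {p}` is a submanifold isomorphic to projective space
      (∃ ι : ℙ 𝕜 (EuclideanSpace 𝕜 (Fin (n + 1))) → V,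
        IsSmoothEmbedding 𝓘(𝕜, EuclideanSpace 𝕜 (Fin n))
          𝓘(𝕜, EuclideanSpace 𝕜 (Fin (n + 1))) ∞ ι ∧ range ι = q ⁻¹' {p}) ∧
      -- charts of `M` centred at `p` lift to the model, and their coordinate changes are the
      -- lifts of the coordinate changes of `M`
      ∃ L : OpenPartialHomeomorph M (EuclideanSpace 𝕜 (Fin (n + 1))) →
          OpenPartialHomeomorph V (BlowupModel 𝕜 (n + 1)),
        (∀ φ ∈ IsManifold.maximalAtlas 𝓘(𝕜, EuclideanSpace 𝕜 (Fin (n + 1))) ∞ M,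
          p ∈ φ.source → φ p = 0 → IsChartLift q φ (L φ)) ∧
        ∀ φ ∈ IsManifold.maximalAtlas 𝓘(𝕜, EuclideanSpace 𝕜 (Fin (n + 1))) ∞ M,
          ∀ ψ ∈ IsManifold.maximalAtlas 𝓘(𝕜, EuclideanSpace 𝕜 (Fin (n + 1))) ∞ M,
            p ∈ φ.source → φ p = 0 → p ∈ ψ.source → ψ p = 0 →
            ∀ z ∈ (L φ).target, φ.symm z.blowdown ∈ ψ.source →
              L ψ ((L φ).symm z) = BlowupModel.lift (ψ ∘ φ.symm) z := by
  obtain ⟨φ₀, hφ₀⟩ := exists_isCentredChart 𝕜 (n + 1) p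
  obtain ⟨L, hL, hcompat⟩ := Blowup.exists_forall_isChartLift (𝕜 := 𝕜) (m := n + 1) (p := p)
  refine ⟨Blowup 𝕜 (n + 1) p, inferInstance, inferInstance, ⟨Blowup.proj, Blowup.continuous_proj⟩,
    inferInstance, fun _ => inferInstance, inferInstance, Blowup.contMDiff_proj,
    Blowup.isTopologicalBlowup_proj, ⟨Blowup.complDiffeomorph 𝕜 (n + 1) p, fun _ => rfl⟩,
    ⟨Blowup.exceptionalMap hφ₀, Blowup.isSmoothEmbedding_exceptionalMap hφ₀,
      Blowup.range_exceptionalMap hφ₀⟩, L, fun φ hφ hp h0 => hL φ ⟨hφ, hp, h0⟩,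
    fun φ hφ ψ hψ hp h0 hp' h0' => hcompat φ ψ ⟨hφ, hp, h0⟩ ⟨hψ, hp', h0'⟩⟩
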